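/- Let $n\ge 1$ and let $\mathrm{QC}(\mathbb R^n)$ be the class of upper semicontinuous functions $f:\mathbb R^n\to[0,\infty)$ that are quasi-concave, i.e. $f(\lambda x+(1-\lambda)y)\ge\min\{f(x),f(y)\}$ for all $x,y\in\mathbb R^n$, $0<\lambda<1$. Put $(f\oplus g)(x)=\sup_{y}\min\{f(y),g(x-y)\}\in[0,\infty]$, $(\lambda\odot f)(x)=f(x/\lambda)$ for $\lambda>0$, and $\overline K_t(f)=\{x: f(x)\ge t\}$ for $t>0$. For non-empty compact convex sets $L_1,\dots,L_n\subset\mathbb R^n$ let $V(L_1,\dots,L_n)=\frac1{n!}\sum_{S\subseteq\{1,\dots,n\}}(-1)^{n-|S|}\,\mathrm{Vol}\big(\sum_{i\in S}L_i\big)$ be their mixed volume; for closed convex sets $K_1,\dots,K_n\subseteq\mathbb R^n$ let $V(K_1,\dots,K_n)\in[0,\infty]$ be the supremum of $V(L_1,\dots,L_n)$ over all non-empty compact convex $L_i\subseteq K_i$ (so $V=0$ if some $K_i$ is empty). Let $m\ge1$, $f_1,\dots,f_m\in\mathrm{QC}(\mathbb R^n)$ and $T=\min_{j}\sup f_j\in[0,\infty]$.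 Then the function $F:(0,\infty)^m\to[0,\infty]$, $$F(\varepsilon_1,\dots,\varepsilon_m)=\int_{\mathbb R^n}(\varepsilon_1\odot f_1)\oplus\cdots\oplus(\varepsilon_m\odot f_m),$$ is a homogeneous polynomial of degree $n$ with non-negative (possibly infinite) coefficients: $$F(\varepsilon_1,\dots,\varepsilon_m)=\sum_{i_1,\dots,i_n=1}^m\varepsilon_{i_1}\cdots\varepsilon_{i_n}\,c(i_1,\dots,i_n),\qquad c(i_1,\dots,i_n)=\int_0^{T}V\big(\overline K_t(f_{i_1}),\dots,\overline K_t(f_{i_n})\big)\,dt,$$ where $c$ is symmetric. If $F$ is finite at some point, then $c$ is the only symmetric function of $(i_1,\dots,i_n)$ with values in $[0,\infty]$ for which this expansion holds on $(0,\infty)^m$. If the indices $i_1,\dots,i_n$ include every element of $\{1,\dots,m\}$, or more generally include some $j$ for which $\sup f_j=T$ (as they always do when all the $f_j$ have the same supremum), then $c(i_1,\dots,i_n)$ is the mixed integral $$V(f_{i_1},\dots,f_{i_n})=\int_0^\infty V\big(\overline K_t(f_{i_1}),\dots,\overline K_t(f_{i_n})\big)\,dt .$$ In particular, for $m=n$ one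 has $c(1,\dots,n)=\int_0^\infty V(\overline K_t(f_1),\dots,\overline K_t(f_n))\,dt$. -/

import Mathlib

open MeasureTheory
open scoped ENNReal Pointwise Nat

noncomputable section

namespace QuasiConcave

/-- The class `QC(ℝⁿ)`: upper semicontinuous quasi-concave functions `ℝⁿ → [0, ∞)`. -/
structure IsQC {n : ℕ} (f : EuclideanSpace ℝ (Fin n) → ℝ) : Prop where
  nonneg : ∀ x, 0 ≤ f x
  upperSemicontinuous : UpperSemicontinuous f
  quasiconcave : QuasiconcaveOn ℝ Set.univ f

/-- A function with values in `[0, ∞)` viewed with values in `[0, ∞]`, since the supremum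
defining `⊕` may be infinite. -/
def toENN {n : ℕ} (f : EuclideanSpace ℝ (Fin n) → ℝ) (x : EuclideanSpace ℝ (Fin n)) : ℝ≥0∞ :=
  ENNReal.ofReal (f x)

/-- `(f ⊕ g)(x) = sup_y min {f(y), g(x - y)}`. -/
def oplus {n : ℕ} (f g : EuclideanSpace ℝ (Fin n) → ℝ≥0∞) (x : EuclideanSpace ℝ (Fin n)) : ℝ≥0∞ :=
  ⨆ y, min (f y) (g (x - y))

/-- `(a ⊙ f)(x) = f(x / a)`, used for `a > 0` only. -/
def odot {n : ℕ} (a : ℝ) (f : EuclideanSpace ℝ (Fin n) → ℝ≥0∞) (x : EuclideanSpace ℝ (Fin n)) :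
    ℝ≥0∞ :=
  f (a⁻¹ • x)

/-- The iterated sum `g 0 ⊕ g 1 ⊕ ⋯ ⊕ g m` of `m + 1` functions, bracketed from the left. -/
def oplusSum {n : ℕ} : (m : ℕ) → (Fin (m + 1) → EuclideanSpace ℝ (Fin n) → ℝ≥0∞) →
    EuclideanSpace ℝ (Fin n) → ℝ≥0∞
  | 0, g => g 0
  | m + 1, g => oplus (oplusSum m fun i => g i.castSucc) (g (Fin.last (m + 1)))

/-- `F(ε) = ∫ (ε 0 ⊙ f 0) ⊕ ⋯ ⊕ (ε m ⊙ f m)`, with value in `[0, ∞]`. -/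
def sumIntegral {n m : ℕ} (f : Fin (m + 1) → EuclideanSpace ℝ (Fin n) → ℝ)
    (ε : Fin (m + 1) → ℝ) : ℝ≥0∞ :=
  ∫⁻ x, oplusSum m (fun i => odot (ε i) (toENN (f i))) x

/-- The upper level set `{x | f x ≥ t}`. -/
def levelSet {n : ℕ} (f : EuclideanSpace ℝ (Fin n) → ℝ) (t : ℝ) :
    Set (EuclideanSpace ℝ (Fin n)) :=
  {x | t ≤ f x}

/-- The mixed volume of `n` convex bodies (non-empty compact convex sets) in `ℝⁿ`: the symmetric
polarization `(1 / n!) ∑_S (-1)^(n - |S|) Vol(∑_{i ∈ S} L i)` of the volume. -/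
def bodyMixedVolume {n : ℕ} (L : Fin n → ConvexBody (EuclideanSpace ℝ (Fin n))) : ℝ :=
  (n ! : ℝ)⁻¹ * ∑ S : Finset (Fin n),
    (-1 : ℝ) ^ (n - S.card) *
      (volume ((∑ i ∈ S, L i : ConvexBody (EuclideanSpace ℝ (Fin n))) :
        Set (EuclideanSpace ℝ (Fin n)))).toReal

/-- The mixed volume, in `[0, ∞]`, of `n` closed convex sets in `ℝⁿ`, not necessarily compact: the
supremum of the mixed volumes of convex bodies contained in them. It is `0` if one of the sets is
empty, since the supremum is then over an empty family. -/
def mixedVolume {n : ℕ} (K : Fin n → Set (EuclideanSpace ℝ (Fin n))) : ℝ≥0∞ :=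
  ⨆ (L : Fin n → ConvexBody (EuclideanSpace ℝ (Fin n)))
    (_ : ∀ i, (L i : Set (EuclideanSpace ℝ (Fin n))) ⊆ K i),
    ENNReal.ofReal (bodyMixedVolume L)

/-- The mixed integral `∫_0^∞ V(K_t(g 1), …, K_t(g n)) dt` of `n` functions on `ℝⁿ`. -/
def mixedIntegral {n : ℕ} (g : Fin n → EuclideanSpace ℝ (Fin n) → ℝ) : ℝ≥0∞ :=
  ∫⁻ t in Set.Ioi (0 : ℝ), mixedVolume fun k => levelSet (g k) t

/-- The supremum of a function, in `[0, ∞]`. -/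
def height {n : ℕ} (f : EuclideanSpace ℝ (Fin n) → ℝ) : ℝ≥0∞ :=
  ⨆ x, toENN f x

/-- The mixed integral of `n` functions, cut off at height `T`:
`∫_0^T V(K_t(g 1), …, K_t(g n)) dt`. -/
def mixedIntegralUpTo {n : ℕ} (T : ℝ≥0∞) (g : Fin n → EuclideanSpace ℝ (Fin n) → ℝ) : ℝ≥0∞ :=
  ∫⁻ t in {t : ℝ | 0 < t ∧ ENNReal.ofReal t < T}, mixedVolume fun k => levelSet (g k) t

/-- `F` is, for positive arguments, the homogeneous polynomial of degree `n` with coefficients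
`c` in `[0, ∞]`: `F(ε) = ∑_{i_1, …, i_n} ε_{i_1} ⋯ ε_{i_n} c(i_1, …, i_n)`, where `c` is
symmetric. -/
def IsSymmExpansion {m n : ℕ} (F : (Fin m → ℝ) → ℝ≥0∞) (c : (Fin n → Fin m) → ℝ≥0∞) : Prop :=
  (∀ (σ : Equiv.Perm (Fin n)) (I : Fin n → Fin m), c (I ∘ σ) = c I) ∧
    ∀ ε : Fin m → ℝ, (∀ i, 0 < ε i) →
      F ε = ∑ I : Fin n → Fin m, ENNReal.ofReal (∏ k, ε (I k)) * c I

end QuasiConcave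

end

/-! The strict superlevel set of the sum at height `t` is the Minkowski combination of the convex
sets `{f i > t}` with coefficients `ε i`. By the layer-cake formula the expansion therefore reduces
to Minkowski's theorem for arbitrary non-empty convex sets (`volume_sum_smul_eq_mixedVolume`). A
Minkowski sum with an empty summand is empty, which is why the integrals stop at the smallest
supremum.

For polytopes, Minkowski's theorem comes from the Cayley trick. Attach to each point of the `i`-th
finite set the `i`-th unit vector as extra coordinates; then `∑ t i • conv (U i)` is the section at
`t` of the cone generated by the lifted points (`slice_eq_sum_smul_convexHull`). Generic heights
split the cone into simplicial cells (`measure_slice_eq_sum`), and the section of such a cell has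
volume a constant times a monomial in `t` (`exists_measure_slice_eq`). If the points of a larger
family that are missing from a smaller one are given much larger heights, the cells of the smaller
family stay cells of the larger one, so the coefficients can only grow (`exists_coeff_slice`).

Polarization identifies the symmetrized coefficients with mixed volumes, which are hence
non-negative and monotone on polytopes. Monotonicity turns the passage to general convex sets into a
supremum over the directed family of inscribed polytopes. Uniqueness holds because one finite value
forces all coefficients to be finite, and then real polynomials can be compared. -/

noncomputable section

namespace QuasiConcave

set_option linter.unusedSectionVars false

/-! ### Regular subdivisions of the Cayley cone -/

section Subdivision

variable {ι E V : Type*} [Fintype ι] [DecidableEq ι] [Fintype E] [DecidableEq E]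
  [NormedAddCommGroup V] [NormedSpace ℝ V]

/-- The Cayley embedding of a family of points `pt e` coloured by `cls e`. -/
def cayley (cls : E → ι) (pt : E → V) (e : E) : (ι → ℝ) × V := (Pi.single (cls e) 1, pt e)

/-- The weights on the points indexed by `D` that represent the vector `z`. -/
def weights (a : E → (ι → ℝ) × V) (D : Finset E) (z : (ι → ℝ) × V) : Set (E → ℝ) :=
  {l | (∀ e, 0 ≤ l e) ∧ (∀ e ∉ D, l e = 0) ∧ ∑ e, l e • a e = z}

/-- The section at `t` of the cone generated by the vectors `a e`, `e ∈ D`. -/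
def slice (a : E → (ι → ℝ) × V) (D : Finset E) (t : ι → ℝ) : Set V :=
  {x | (weights a D (t, x)).Nonempty}

/-- `B` indexes a basis consisting of vectors `a e`. -/
def IsBasisSet (a : E → (ι → ℝ) × V) (B : Finset E) : Prop :=
  LinearIndepOn ℝ a (B : Set E) ∧ Submodule.span ℝ (a '' (B : Set E)) = ⊤

/-- The heights `w` are generic: a hyperplane through lifted basis vectors contains no other
lifted vector. -/
def IsGeneric (a : E → (ι → ℝ) × V) (w : E → ℝ) : Prop :=
  ∀ B, IsBasisSet a B → ∀ y : (ι → ℝ) × V →ₗ[ℝ] ℝ, (∀ e ∈ B, y (a e) = w e) →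
    ∀ j ∉ B, y (a j) ≠ w j

/-- `B` is a cell of the regular subdivision of the cone over `D` defined by the heights `w`. -/
def IsCell (a : E → (ι → ℝ) × V) (w : E → ℝ) (D B : Finset E) : Prop :=
  B ⊆ D ∧ IsBasisSet a B ∧ ∃ y : (ι → ℝ) × V →ₗ[ℝ] ℝ, (∀ e ∈ B, y (a e) = w e) ∧
    ∀ e ∈ D, e ∉ B → y (a e) < w e

theorem slice_mono {a : E → (ι → ℝ) × V} {D D' : Finset E} (h : D ⊆ D') (t : ι → ℝ) :
    slice a D t ⊆ slice a D' t := by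
  rintro x ⟨l, h0, hD, hs⟩
  exact ⟨l, h0, fun e he => hD e fun h' => he (h h'), hs⟩

theorem sum_weights_eq {cls : E → ι} {pt : E → V} {l : E → ℝ} {t : ι → ℝ} {x : V}
    (h : ∑ e, l e • cayley cls pt e = (t, x)) :
    (∀ i, ∑ e, (if cls e = i then l e else 0) = t i) ∧ ∑ e, l e • pt e = x := by
  rw [Prod.ext_iff, Prod.fst_sum, Prod.snd_sum] at h
  refine ⟨fun i => ?_, by simpa [cayley] using h.2⟩
  have := congrFun h.1 i
  simp only [cayley, Prod.smul_mk, Finset.sum_apply, Pi.smul_apply, smul_eq_mul] at this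
  rw [← this]
  refine Finset.sum_congr rfl fun e _ => ?_
  by_cases hi : cls e = i
  · subst hi; simp
  · simp [hi, Ne.symm hi]

/-- The weights of one colour add up to the corresponding coordinate of `t`. This bound is the
source of all compactness below. -/
theorem weights_bound {cls : E → ι} {pt : E → V} {l : E → ℝ} {t : ι → ℝ} {x : V}
    (h0 : ∀ e, 0 ≤ l e) (h : ∑ e, l e • cayley cls pt e = (t, x)) (e : E) : l e ≤ t (cls e) := by
  rw [← (sum_weights_eq h).1 (cls e)]
  have := Finset.single_le_sum (f := fun e' => if cls e' = cls e then l e' else 0)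
    (fun e' _ => by split_ifs <;> simp [h0]) (Finset.mem_univ e)
  simpa using this

theorem isClosed_weights (a : E → (ι → ℝ) × V) (D : Finset E) (z : (ι → ℝ) × V) :
    IsClosed (weights a D z) := by
  refine IsClosed.inter (s₁ := {l : E → ℝ | ∀ e, 0 ≤ l e}) ?_ (IsClosed.inter
    (s₁ := {l : E → ℝ | ∀ e ∉ D, l e = 0}) ?_ (isClosed_eq (by fun_prop) continuous_const))
  · simp only [Set.ofPred_forall]
    exact isClosed_iInter fun e => isClosed_le continuous_const (continuous_apply e)
  · simp only [Set.ofPred_forall]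
    exact isClosed_iInter fun e => isClosed_iInter fun _ =>
      isClosed_eq (continuous_apply e) continuous_const

theorem isCompact_weights (cls : E → ι) (pt : E → V) (D : Finset E) (t : ι → ℝ) (x : V) :
    IsCompact (weights (cayley cls pt) D (t, x)) :=
  (isCompact_Icc (a := (0 : E → ℝ)) (b := fun e => t (cls e))).of_isClosed_subset
    (isClosed_weights _ _ _) fun _ hl => ⟨hl.1, weights_bound hl.1 hl.2.2⟩

theorem isCompact_slice (cls : E → ι) (pt : E → V) (D : Finset E) (t : ι → ℝ) :
    IsCompact (slice (cayley cls pt) D t) := by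
  have hK : IsCompact {l : E → ℝ | ((∀ e, 0 ≤ l e) ∧ (∀ e ∉ D, l e = 0)) ∧
      (∑ e, l e • cayley cls pt e).1 = t} := by
    refine (isCompact_Icc (a := (0 : E → ℝ)) (b := fun e => t (cls e))).of_isClosed_subset ?_
      fun l hl => ⟨hl.1.1, weights_bound (pt := pt) hl.1.1 (Prod.ext hl.2 rfl)⟩
    refine IsClosed.inter (IsClosed.inter (s₁ := {l : E → ℝ | ∀ e, 0 ≤ l e}) ?_
      (s₂ := {l : E → ℝ | ∀ e ∉ D, l e = 0}) ?_) (isClosed_eq (by fun_prop) continuous_const)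
    · simp only [Set.ofPred_forall]
      exact isClosed_iInter fun e => isClosed_le continuous_const (continuous_apply e)
    · simp only [Set.ofPred_forall]
      exact isClosed_iInter fun e => isClosed_iInter fun _ =>
        isClosed_eq (continuous_apply e) continuous_const
  convert hK.image (f := fun l => (∑ e, l e • cayley cls pt e).2) (by fun_prop) using 1
  ext x
  constructor
  · rintro ⟨l, h0, hD, hs⟩
    exact ⟨l, ⟨⟨h0, hD⟩, by rw [hs]⟩, by simp only [hs]⟩
  · rintro ⟨l, ⟨⟨h0, hD⟩, h1⟩, h2⟩
    exact ⟨l, h0, hD, Prod.ext h1 h2⟩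

theorem mem_span_of_weights {a : E → (ι → ℝ) × V} {l : E → ℝ} {z : (ι → ℝ) × V} {S : Finset E}
    (hS : ∀ e ∉ S, l e = 0) (h : ∑ e, l e • a e = z) :
    z ∈ Submodule.span ℝ (a '' (S : Set E)) := by
  rw [← h]
  refine Submodule.sum_mem _ fun e _ => ?_
  by_cases he : e ∈ S
  · exact Submodule.smul_mem _ _ (Submodule.subset_span ⟨e, he, rfl⟩)
  · rw [hS e he, zero_smul]; exact Submodule.zero_mem _

theorem exists_mem_of_mem_span {cls : E → ι} {pt : E → V} {t : ι → ℝ} {x : V} {S : Finset E}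
    (h : (t, x) ∈ Submodule.span ℝ (cayley cls pt '' (S : Set E))) (i : ι) (hi : t i ≠ 0) :
    ∃ e ∈ S, cls e = i := by
  by_contra! hc
  have : Submodule.span ℝ (cayley cls pt '' (S : Set E)) ≤
      LinearMap.ker (LinearMap.proj i ∘ₗ LinearMap.fst ℝ (ι → ℝ) V) := by
    rw [Submodule.span_le]
    rintro _ ⟨e, he, rfl⟩
    simp [cayley, Ne.symm (hc e he)]
  exact hi (by simpa using this h)

/-- A proper subspace spanned by embedded points has a negligible section at a positive `t`. -/
theorem measure_section_span [FiniteDimensional ℝ V] [MeasurableSpace V] [BorelSpace V]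
    (μ : Measure V) [μ.IsAddHaarMeasure] {cls : E → ι} {pt : E → V} {t : ι → ℝ}
    (ht : ∀ i, 0 < t i) {S : Finset E}
    (hS : Submodule.span ℝ (cayley cls pt '' (S : Set E)) ≠ ⊤) :
    μ {x | (t, x) ∈ Submodule.span ℝ (cayley cls pt '' (S : Set E))} = 0 := by
  set H := Submodule.span ℝ (cayley cls pt '' (S : Set E)) with hH
  rcases Set.eq_empty_or_nonempty {x | (t, x) ∈ H} with h | ⟨x₀, hx₀⟩
  · rw [h, measure_empty]
  -- Positivity of `t` makes every colour occur in `S`. If `H` contained `0 × V`, it would then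
  -- contain all `(e_i, 0)` as well, and so be the whole space.
  have hne : H.comap (LinearMap.inr ℝ (ι → ℝ) V) ≠ ⊤ := by
    intro htop
    have hr : ∀ x : V, ((0 : ι → ℝ), x) ∈ H := fun x => by
      have : x ∈ H.comap (LinearMap.inr ℝ (ι → ℝ) V) := htop ▸ Submodule.mem_top
      simpa using this
    have hl : ∀ i, ((Pi.single i 1 : ι → ℝ), (0 : V)) ∈ H := fun i => by
      obtain ⟨e, he, rfl⟩ := exists_mem_of_mem_span hx₀ i (ht i).ne'
      have h1 : cayley cls pt e ∈ H := Submodule.subset_span ⟨e, he, rfl⟩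
      simpa [cayley] using H.sub_mem h1 (hr (pt e))
    apply hS
    rw [eq_top_iff]
    rintro ⟨s, x⟩ -
    have : ((s, x) : (ι → ℝ) × V) = ∑ i, s i • ((Pi.single i 1 : ι → ℝ), (0 : V)) + (0, x) := by
      ext j
      · simp [Prod.fst_sum, Finset.sum_apply, Pi.single_apply]
      · simp [Prod.snd_sum]
    rw [this]
    exact H.add_mem (H.sum_mem fun i _ => H.smul_mem _ (hl i)) (hr x)
  have hset : {x | (t, x) ∈ H} = (fun x => x + (-x₀)) ⁻¹' (H.comap (LinearMap.inr ℝ (ι → ℝ) V)) := by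
    ext x
    simp only [Set.mem_ofPred_eq, Set.mem_preimage, SetLike.mem_coe, Submodule.mem_comap,
      LinearMap.inr_apply]
    rw [show ((0 : ι → ℝ), x + -x₀) = (t, x) - (t, x₀) by simp [sub_eq_add_neg]]
    exact (H.sub_mem_iff_left hx₀).symm
  rw [hset, measure_preimage_add_right]
  exact Measure.addHaar_submodule μ _ hne

/-- Two cells overlap only along a common face. -/
theorem aedisjoint_slice [FiniteDimensional ℝ V] [MeasurableSpace V] [BorelSpace V]
    (μ : Measure V) [μ.IsAddHaarMeasure] {cls : E → ι} {pt : E → V} {t : ι → ℝ}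
    (ht : ∀ i, 0 < t i) {w : E → ℝ} {D B B' : Finset E} (hB : IsCell (cayley cls pt) w D B)
    (hB' : IsCell (cayley cls pt) w D B') (hne : B ≠ B') :
    AEDisjoint μ (slice (cayley cls pt) B t) (slice (cayley cls pt) B' t) := by
  obtain ⟨hBD, ⟨hli, hsp⟩, y, hy, hy'⟩ := hB
  obtain ⟨hBD', ⟨hli', hsp'⟩, z, hz, hz'⟩ := hB'
  set a := cayley cls pt
  -- Two distinct bases meet in a proper subset of each, which cannot span.
  have key : Submodule.span ℝ (a '' ((B ∩ B' : Finset E) : Set E)) ≠ ⊤ := by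
    intro htop
    have h1 : ∀ C : Finset E, LinearIndepOn ℝ a (C : Set E) → B ∩ B' ⊆ C → C ⊆ B ∩ B' := by
      intro C hC hsub j hj
      by_contra hj'
      have hins := hC.mono (t := insert j ((B ∩ B' : Finset E) : Set E))
        (Set.insert_subset hj (Finset.coe_subset.2 hsub))
      exact hj' (((hC.mono (Finset.coe_subset.2 hsub)).mem_span_iff (a := j)).1
        (htop ▸ Submodule.mem_top) hins)
    exact hne (((h1 B hli Finset.inter_subset_left).trans Finset.inter_subset_right).antisymm
      ((h1 B' hli' Finset.inter_subset_right).trans Finset.inter_subset_left))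
  refine measure_mono_null ?_ (measure_section_span μ ht key)
  rintro x ⟨⟨l, hl0, hlB, hl⟩, ⟨l', hl0', hlB', hl'⟩⟩
  refine mem_span_of_weights (l := l') ?_ hl'
  -- Complementary slackness: the costs satisfy `cost l = y (t, x) ≤ cost l' = z (t, x) ≤ cost l`.
  -- Equality forces `l'` to vanish wherever `y (a e) < w e`, in particular on `B'` outside `B`.
  have cost : ∀ (l : E → ℝ) (y : (ι → ℝ) × V →ₗ[ℝ] ℝ), ∑ e, l e • a e = (t, x) →
      ∑ e, l e * (w e - y (a e)) = ∑ e, l e * w e - y (t, x) := by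
    intro l y h
    rw [← h, map_sum, ← Finset.sum_sub_distrib]
    exact Finset.sum_congr rfl fun e _ => by rw [map_smul, smul_eq_mul]; ring
  have zero : ∀ (B : Finset E) (l : E → ℝ) (y : (ι → ℝ) × V →ₗ[ℝ] ℝ), (∀ e ∉ B, l e = 0) →
      (∀ e ∈ B, y (a e) = w e) → ∑ e, l e * (w e - y (a e)) = 0 := by
    intro B l y h h'
    refine Finset.sum_eq_zero fun e _ => ?_
    by_cases he : e ∈ B
    · rw [h' e he]; ring
    · rw [h e he]; ring
  have pos : ∀ (B C : Finset E) (l : E → ℝ) (y : (ι → ℝ) × V →ₗ[ℝ] ℝ), C ⊆ D → (∀ e, 0 ≤ l e) →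
      (∀ e ∉ C, l e = 0) → (∀ e ∈ B, y (a e) = w e) → (∀ e ∈ D, e ∉ B → y (a e) < w e) →
      ∀ e ∈ Finset.univ, 0 ≤ l e * (w e - y (a e)) := by
    intro B C l y hC h0 h1 h2 h3 e _
    by_cases he : e ∈ C
    · by_cases he' : e ∈ B
      · rw [h2 e he']; simp
      · exact mul_nonneg (h0 e) (sub_nonneg.2 (h3 e (hC he) he').le)
    · rw [h1 e he]; simp
  have e1 := zero B l y hlB hy
  have e2 := zero B' l' z hlB' hz
  have p1 := pos B B' l' y hBD' hl0' hlB' hy hy'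
  have p2 := Finset.sum_nonneg (pos B' B l z hBD hl0 hlB hz hz')
  have p1' := Finset.sum_nonneg p1
  rw [cost _ _ hl] at e1 p2
  rw [cost _ _ hl'] at e2 p1'
  have e3 : ∑ e, l' e * (w e - y (a e)) = 0 := by rw [cost _ _ hl']; linarith
  rw [Finset.sum_eq_zero_iff_of_nonneg p1] at e3
  intro e he
  by_cases hmem : e ∈ B'
  · have heB : e ∉ B := fun h => he (Finset.mem_inter.2 ⟨h, hmem⟩)
    exact (mul_eq_zero.1 (e3 e (Finset.mem_univ e))).resolve_right
      (sub_pos.2 (hy' e (hBD' hmem) heB)).ne'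
  · exact hlB' e hmem

/-- An optimal weight cannot be improved in an admissible direction. -/
theorem cost_nonneg_of_isMinOn {a : E → (ι → ℝ) × V} {w : E → ℝ} {D : Finset E}
    {z : (ι → ℝ) × V} {l d : E → ℝ} (hl : l ∈ weights a D z)
    (hmin : IsMinOn (fun l => ∑ e, l e * w e) (weights a D z) l)
    (hdD : ∀ e ∉ D, d e = 0) (hd : ∑ e, d e • a e = 0) (hneg : ∀ e, d e < 0 → 0 < l e) :
    0 ≤ ∑ e, d e * w e := by
  have hev : ∀ᶠ s in nhdsWithin (0 : ℝ) (Set.Ioi 0), 0 < s ∧ ∀ e, 0 ≤ l e + s * d e := by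
    refine (eventually_mem_nhdsWithin).and (Filter.eventually_all.2 fun e => ?_)
    by_cases h : d e < 0
    · have hc : ContinuousAt (fun s : ℝ => l e + s * d e) 0 := by fun_prop
      have := hc.eventually (lt_mem_nhds (a := 0) (by simpa using hneg e h))
      exact nhdsWithin_le_nhds (this.mono fun s hs => hs.le)
    · filter_upwards [eventually_mem_nhdsWithin] with s hs
      have := hl.1 e
      have := mul_nonneg (le_of_lt hs) (not_lt.1 h)
      linarith
  obtain ⟨s, hs, hpos⟩ := hev.exists
  have hmem : (fun e => l e + s * d e) ∈ weights a D z := by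
    refine ⟨hpos, fun e he => by simp [hl.2.1 e he, hdD e he], ?_⟩
    simp only [add_smul, mul_smul, Finset.sum_add_distrib, ← Finset.smul_sum, hd, hl.2.2]
    simp
  have := hmin hmem
  simp only [Set.mem_ofPred_eq, add_mul, Finset.sum_add_distrib, mul_assoc,
    ← Finset.mul_sum] at this
  have h2 : 0 ≤ s * ∑ e, d e * w e := by linarith
  exact nonneg_of_mul_nonneg_right h2 hs

/-- Linear programming: take a weight of least cost representing `(t, x)`. Its support spans by
`hgen`, hence contains a basis `B`, and `y` interpolates the heights on `B`. Exchanging a further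
vector `j` into the basis changes the cost by `w j - y (a j)`, which is non-negative by optimality
and non-zero by genericity. Were `l j` positive, the reverse exchange would lower the cost, so `l`
lives on `B`. -/
theorem exists_isCell_mem_slice {cls : E → ι} {pt : E → V} {w : E → ℝ}
    (hw : IsGeneric (cayley cls pt) w) {D : Finset E} {t : ι → ℝ} {x : V}
    (hx : x ∈ slice (cayley cls pt) D t)
    (hgen : ∀ S : Finset E, (t, x) ∈ Submodule.span ℝ (cayley cls pt '' (S : Set E)) →
      Submodule.span ℝ (cayley cls pt '' (S : Set E)) = ⊤) :
    ∃ B, IsCell (cayley cls pt) w D B ∧ x ∈ slice (cayley cls pt) B t := by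
  set a := cayley cls pt with ha
  obtain ⟨l, hl, hmin⟩ := (isCompact_weights cls pt D t x).exists_isMinOn hx
    (f := fun l => ∑ e, l e * w e) (by fun_prop)
  rw [← ha] at hl hmin
  have hS : Submodule.span ℝ (a '' ((Finset.univ.filter fun e => l e ≠ 0 : Finset E) : Set E)) = ⊤ :=
    hgen _ (mem_span_of_weights (fun e he => by simpa using he) hl.2.2)
  obtain ⟨B, hBS, -, hspan, hli⟩ := exists_linearIndepOn_extension (K := ℝ) (v := a)
    (linearIndepOn_empty ℝ a) (Set.empty_subset {e | l e ≠ 0})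
  lift B to Finset E using B.toFinite
  have hbas : IsBasisSet a B := by
    refine ⟨hli, top_le_iff.1 ?_⟩
    rw [← hS, Submodule.span_le]
    simpa using hspan
  have hBpos : ∀ e ∈ B, 0 < l e := fun e he => lt_of_le_of_ne (hl.1 e) (Ne.symm (hBS he))
  have hBD : B ⊆ D := fun e he => by
    by_contra h
    exact hBS he (hl.2.1 e h)
  let b : Module.Basis B ℝ ((ι → ℝ) × V) := Module.Basis.mk hli (by
    rw [← hbas.2, Set.image_eq_range])
  have hb : ∀ e : B, b e = a e := fun e => by simp [b]
  let y := b.constr ℝ (fun e : B => w e)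
  have hy : ∀ e ∈ B, y (a e) = w e := fun e he => by
    rw [← hb ⟨e, he⟩, Module.Basis.constr_basis]
  -- the exchange direction that increases the weight of `j`
  have hdir : ∀ j ∉ B, j ∈ D → ∃ d : E → ℝ, (∀ e ∉ D, d e = 0) ∧ ∑ e, d e • a e = 0 ∧
      d j = 1 ∧ (∀ e ∉ B, e ≠ j → d e = 0) ∧ ∑ e, d e * w e = w j - y (a j) := by
    intro j hj hjD
    let β : E → ℝ := fun e => if h : e ∈ B then b.repr (a j) ⟨e, h⟩ else 0
    have hβ0 : ∀ e ∉ B, β e = 0 := fun e he => by simp [β, he]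
    have hβ : ∑ e, β e • a e = a j := by
      rw [← Finset.sum_subset (Finset.subset_univ B) fun e _ he => by rw [hβ0 e he, zero_smul],
        ← Finset.sum_coe_sort]
      conv_rhs => rw [← b.sum_repr (a j)]
      exact Finset.sum_congr rfl fun e _ => by simp [β, hb]
    refine ⟨fun e => (if e = j then 1 else 0) - β e, fun e he => ?_, ?_, ?_, fun e he hej => ?_, ?_⟩
    · have h1 : e ≠ j := fun h => he (h ▸ hjD)
      simp [h1, hβ0 e fun h => he (hBD h)]
    · simp [sub_smul, Finset.sum_sub_distrib, hβ]
    · simp [hβ0 j hj]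
    · simp [hβ0 e he, hej]
    · rw [← hβ, map_sum]
      simp only [sub_mul, Finset.sum_sub_distrib, ite_mul, one_mul, zero_mul,
        Finset.sum_ite_eq', Finset.mem_univ, if_true, map_smul, smul_eq_mul]
      congr 1
      refine Finset.sum_congr rfl fun e _ => ?_
      by_cases he : e ∈ B
      · rw [hy e he]
      · rw [hβ0 e he]; ring
  have hlt : ∀ j ∈ D, j ∉ B → y (a j) < w j := by
    intro j hjD hj
    obtain ⟨d, h1, h2, h3, h4, h5⟩ := hdir j hj hjD
    refine lt_of_le_of_ne ?_ (hw B hbas y hy j hj)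
    rw [← sub_nonneg, ← h5]
    refine cost_nonneg_of_isMinOn hl hmin h1 h2 fun e he => ?_
    by_cases heB : e ∈ B
    · exact hBpos e heB
    · by_cases hej : e = j
      · subst hej; linarith
      · rw [h4 e heB hej] at he; exact absurd he (lt_irrefl _)
  refine ⟨B, ⟨hBD, hbas, y, hy, hlt⟩, l, hl.1, fun j hj => ?_, hl.2.2⟩
  by_contra hlj
  have hjD : j ∈ D := by
    by_contra h
    exact hlj (hl.2.1 j h)
  obtain ⟨d, h1, h2, h3, h4, h5⟩ := hdir j hj hjD
  have := cost_nonneg_of_isMinOn (d := fun e => - d e) hl hmin (fun e he => by simp [h1 e he])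
    (by simp [h2]) fun e he => ?_
  · simp only [neg_mul, Finset.sum_neg_distrib, h5] at this
    linarith [hlt j hjD hj]
  by_cases heB : e ∈ B
  · exact hBpos e heB
  · by_cases hej : e = j
    · subst hej; exact lt_of_le_of_ne (hl.1 e) (Ne.symm hlj)
    · simp [h4 e heB hej] at he

-- The cells cover every point outside finitely many null sections of proper subspaces, and their
-- overlaps are null.
open Classical in
theorem measure_slice_eq_sum [FiniteDimensional ℝ V] [MeasurableSpace V] [BorelSpace V]
    (μ : Measure V) [μ.IsAddHaarMeasure] {cls : E → ι} {pt : E → V} {t : ι → ℝ}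
    (ht : ∀ i, 0 < t i) {w : E → ℝ} (hw : IsGeneric (cayley cls pt) w) (D : Finset E) :
    μ (slice (cayley cls pt) D t) =
      ∑ B with IsCell (cayley cls pt) w D B, μ (slice (cayley cls pt) B t) := by
  set a := cayley cls pt with ha
  rw [← measure_biUnion_finset₀]
  · apply le_antisymm
    · have hnull : μ (⋃ S : Finset E, {x | (t, x) ∈ Submodule.span ℝ (a '' (S : Set E)) ∧
          Submodule.span ℝ (a '' (S : Set E)) ≠ ⊤}) = 0 := by
        refine measure_iUnion_null fun S => ?_
        by_cases hS : Submodule.span ℝ (a '' (S : Set E)) = ⊤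
        · simp [hS]
        · exact measure_mono_null (fun x hx => hx.1) (measure_section_span μ ht hS)
      refine measure_mono_ae ?_
      filter_upwards [measure_eq_zero_iff_ae_notMem.1 hnull] with x hxn hx
      obtain ⟨B, hB, hxB⟩ := exists_isCell_mem_slice hw hx fun S hS => by
        by_contra h
        exact hxn (Set.mem_iUnion.2 ⟨S, hS, h⟩)
      exact Set.mem_biUnion (by simpa using hB) hxB
    · refine measure_mono (Set.iUnion₂_subset fun B hB => slice_mono ?_ t)
      simp only [Finset.mem_filter, Finset.mem_univ, true_and] at hB
      exact hB.1
  · intro B hB B' hB' hne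
    simp only [Finset.coe_filter, Finset.mem_univ, true_and, Set.mem_ofPred_eq] at hB hB'
    exact aedisjoint_slice μ ht hB hB' hne
  · exact fun B _ => (isCompact_slice cls pt B t).measurableSet.nullMeasurableSet

end Subdivision

/-! ### Monomial volumes and monotone coefficients -/

section Coefficients

variable {ι E V : Type*} [Fintype ι] [DecidableEq ι] [Fintype E] [DecidableEq E]
  [NormedAddCommGroup V] [NormedSpace ℝ V]

/-- The difference of the two sides is a polynomial in `M` whose coefficient at `idx j` is `±1`,
since no other exponent equals `idx j`; it has finitely many roots. -/
theorem eventually_pow_sub_sum_ne {idx : E → ℕ} (hidx : Function.Injective idx) (B : Finset E)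
    {j : E} (hj : j ∉ B) (β : E → ℝ) :
    ∀ᶠ M : ℝ in Filter.atTop, ∑ e ∈ B, β e * M ^ idx e ≠ M ^ idx j := by
  classical
  let P : Polynomial ℝ := Polynomial.X ^ idx j - ∑ e ∈ B, Polynomial.C (β e) * Polynomial.X ^ idx e
  have hP : P ≠ 0 := by
    intro h
    have h1 : P.coeff (idx j) = 1 := by
      simp only [P, Polynomial.coeff_sub, Polynomial.finsetSum_coeff, Polynomial.coeff_C_mul,
        Polynomial.coeff_X_pow, if_true]
      rw [Finset.sum_eq_zero, sub_zero]
      intro e he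
      rw [if_neg fun h => hj ((hidx h : j = e) ▸ he), mul_zero]
    simp [h] at h1
  filter_upwards [P.eventually_atTop_not_isRoot hP] with M hM h
  exact hM (by simp [P, Polynomial.IsRoot, Polynomial.eval_finsetSum, h])

theorem eventually_sum_lt_pow {idx : E → ℕ} (B : Finset E) {j : E}
    (hj : ∀ e ∈ B, idx e < idx j) (β : E → ℝ) :
    ∀ᶠ M : ℝ in Filter.atTop, ∑ e ∈ B, β e * M ^ idx e < M ^ idx j := by
  have h : (fun M : ℝ => ∑ e ∈ B, β e * M ^ idx e) =o[Filter.atTop] fun M : ℝ => M ^ idx j :=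
    Asymptotics.IsLittleO.fun_sum fun e he =>
      (Asymptotics.isLittleO_pow_pow_atTop_of_lt (hj e he)).const_mul_left _
  filter_upwards [h.def (c := 1 / 2) (by norm_num), Filter.eventually_gt_atTop 0] with M hM hpos
  have h1 : 0 < M ^ idx j := by positivity
  rw [Real.norm_eq_abs, Real.norm_eq_abs, abs_of_pos h1] at hM
  linarith [le_abs_self (∑ e ∈ B, β e * M ^ idx e)]

/-- Generic heights for which the points outside `D₀` lie above every hyperplane through a lifted
basis from `D₀`. -/
theorem exists_isGeneric (a : E → (ι → ℝ) × V) (D₀ : Finset E) :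
    ∃ w : E → ℝ, IsGeneric a w ∧ ∀ B ⊆ D₀, IsBasisSet a B →
      ∀ y : (ι → ℝ) × V →ₗ[ℝ] ℝ, (∀ e ∈ B, y (a e) = w e) → ∀ j ∉ D₀, y (a j) < w j := by
  let eq := Fintype.equivFin E
  -- The heights will be `M ^ idx e` with `M` large. Numbering `D₀` first makes the heights outside
  -- `D₀` dominate any fixed linear combination of heights inside.
  let idx : E → ℕ := fun e => if e ∈ D₀ then (eq e : ℕ) else Fintype.card E + eq e
  have hidx : Function.Injective idx := by
    intro e e' h
    have h1 := (eq e).2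
    have h2 := (eq e').2
    apply eq.injective
    apply Fin.ext
    simp only [idx] at h
    split_ifs at h <;> omega
  have hidx' : ∀ e ∈ D₀, ∀ j ∉ D₀, idx e < idx j := by
    intro e he j hj
    have h1 := (eq e).2
    simp only [idx, he, hj, if_true, if_false]
    omega
  have hrep : ∀ B : Finset E, IsBasisSet a B → ∀ j, ∃ β : E → ℝ, ∑ e ∈ B, β e • a e = a j := by
    intro B hB j
    have : a j ∈ Submodule.span ℝ (a '' (B : Set E)) := hB.2 ▸ Submodule.mem_top
    obtain ⟨β, hβ⟩ := (Submodule.mem_span_image_finset_iff_exists_fun ℝ).1 this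
    refine ⟨fun e => if h : e ∈ B then β ⟨e, h⟩ else 0, ?_⟩
    rw [← hβ, ← Finset.sum_coe_sort]
    simp
  have hval : ∀ (B : Finset E) (β : E → ℝ) (j : E) (w : E → ℝ) (y : (ι → ℝ) × V →ₗ[ℝ] ℝ),
      ∑ e ∈ B, β e • a e = a j → (∀ e ∈ B, y (a e) = w e) → y (a j) = ∑ e ∈ B, β e * w e := by
    intro B β j w y h hy
    rw [← h, map_sum]
    exact Finset.sum_congr rfl fun e he => by rw [map_smul, smul_eq_mul, hy e he]
  have hev : ∀ᶠ M : ℝ in Filter.atTop, ∀ (B : Finset E) (j : E), IsBasisSet a B →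
      ∀ y : (ι → ℝ) × V →ₗ[ℝ] ℝ, (∀ e ∈ B, y (a e) = M ^ idx e) →
      (j ∉ B → y (a j) ≠ M ^ idx j) ∧ (B ⊆ D₀ → j ∉ D₀ → y (a j) < M ^ idx j) := by
    refine Filter.eventually_all.2 fun B => Filter.eventually_all.2 fun j => ?_
    by_cases hB : IsBasisSet a B
    swap
    · exact Filter.Eventually.of_forall fun M h => absurd h hB
    obtain ⟨β, hβ⟩ := hrep B hB j
    have h1 : ∀ᶠ M : ℝ in Filter.atTop, j ∉ B → ∑ e ∈ B, β e * M ^ idx e ≠ M ^ idx j := by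
      by_cases hj : j ∈ B
      · exact Filter.Eventually.of_forall fun M h => absurd hj h
      · exact (eventually_pow_sub_sum_ne hidx B hj β).mono fun M h _ => h
    have h2 : ∀ᶠ M : ℝ in Filter.atTop, B ⊆ D₀ → j ∉ D₀ →
        ∑ e ∈ B, β e * M ^ idx e < M ^ idx j := by
      by_cases hBD : B ⊆ D₀
      · by_cases hj : j ∈ D₀
        · exact Filter.Eventually.of_forall fun M _ h => absurd hj h
        · exact (eventually_sum_lt_pow B (fun e he => hidx' e (hBD he) j hj) β).mono
            fun M h _ _ => h
      · exact Filter.Eventually.of_forall fun M h => absurd h hBD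
    filter_upwards [h1, h2] with M h1 h2 _ y hy
    rw [hval B β j _ y hβ hy]
    exact ⟨h1, h2⟩
  obtain ⟨M, hM⟩ := hev.exists
  exact ⟨fun e => M ^ idx e, fun B hB y hy j => (hM B j hB y hy).1,
    fun B hBD hB y hy j => (hM B j hB y hy).2 hBD⟩

/-- The section of a simplicial cone is a product of simplices: its volume is a monomial. -/
theorem exists_measure_slice_eq [FiniteDimensional ℝ V] [MeasurableSpace V] [BorelSpace V]
    (μ : Measure V) [μ.IsAddHaarMeasure] (cls : E → ι) (pt : E → V) {n : ℕ}
    (hn : Module.finrank ℝ V = n) {B : Finset E} (hB : IsBasisSet (cayley cls pt) B) :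
    ∃ J : Fin n → ι, ∀ t : ι → ℝ, (∀ i, 0 < t i) → μ (slice (cayley cls pt) B t) =
      ENNReal.ofReal (∏ k, t (J k)) * μ (slice (cayley cls pt) B fun _ => 1) := by
  set a := cayley cls pt with ha
  obtain ⟨hli, hsp⟩ := hB
  have hrep : ∀ i, ∃ e ∈ B, cls e = i := fun i =>
    exists_mem_of_mem_span (cls := cls) (pt := pt) (S := B) (t := fun _ => 1) (x := 0)
      (by rw [← ha, hsp]; exact Submodule.mem_top) i one_ne_zero
  choose r hrB hr using hrep
  have hrinj : Function.Injective r := fun i j h => by rw [← hr i, h, hr]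
  -- With one representative `r i` removed per colour, `n` vectors remain; their differences `v`
  -- from the representatives form a basis of `V`.
  let N : Finset E := B \ Finset.univ.image r
  let v : E → V := fun e => pt e - pt (r (cls e))
  have hvr : ∀ e ∈ B, e ∉ N → v e = 0 := by
    intro e he heN
    have : ∃ i, r i = e := by simpa [N, he] using heN
    obtain ⟨i, rfl⟩ := this
    simp [v, hr]
  have hliB : ∀ g : E → ℝ, (∀ e ∉ B, g e = 0) → ∑ e, g e • a e = 0 → ∀ e, g e = 0 := by
    intro g hg h e
    by_cases he : e ∈ B
    · rw [← Finset.sum_subset (Finset.subset_univ B) fun e _ he => by rw [hg e he, zero_smul]] at h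
      exact linearIndepOn_finset_iff.1 hli g h e he
    · exact hg e he
  have hliN : LinearIndepOn ℝ v (N : Set E) := by
    rw [linearIndepOn_finset_iff]
    intro g hg e he
    let g' : E → ℝ := fun e => if e ∈ N then g e else 0
    have hN : ∀ e ∈ N, e ∈ B := fun e he => (Finset.mem_sdiff.1 he).1
    have hNr : ∀ e ∈ N, ∀ i, r i ≠ e := fun e he i h =>
      (Finset.mem_sdiff.1 he).2 (Finset.mem_image.2 ⟨i, Finset.mem_univ i, h⟩)
    have hav : ∀ e, a e - a (r (cls e)) = (0, v e) := fun e => by simp [ha, cayley, hr, v]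
    have hsum : ∑ e, g' e • (a e - a (r (cls e))) = 0 := by
      simp only [hav, g', ite_smul, zero_smul, Finset.sum_ite_mem, Finset.univ_inter]
      rw [Prod.ext_iff, Prod.fst_sum, Prod.snd_sum]
      simpa using hg
    -- A relation among the `v e` lifts to the vectors `a e` once each representative receives minus
    -- the total weight of its colour.
    have hz := hliB (fun e => g' e - ∑ e', if r (cls e') = e then g' e' else 0) (fun e he => ?_) ?_ e
    · rw [Finset.sum_eq_zero fun e' _ => if_neg (hNr e he _)] at hz
      simpa [g', he] using hz
    · have h1 : e ∉ N := fun h => he (hN e h)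
      rw [Finset.sum_eq_zero fun e' _ => if_neg fun h : r (cls e') = e => he (h ▸ hrB _)]
      simp [g', h1]
    · rw [← hsum]
      simp only [sub_smul, smul_sub, Finset.sum_sub_distrib, Finset.sum_smul]
      congr 1
      rw [Finset.sum_comm]
      refine Finset.sum_congr rfl fun e' _ => ?_
      simp [ite_smul]
  have hcard : N.card = n := by
    have h1 : Module.finrank ℝ ((ι → ℝ) × V) = B.card := by
      rw [Module.finrank_eq_card_basis (Module.Basis.mk hli (by
        rw [← hsp, Set.image_eq_range]))]
      simp
    have h2 : (Finset.univ.image r).card = Fintype.card ι := by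
      rw [Finset.card_image_of_injective _ hrinj, Finset.card_univ]
    have h3 : Finset.univ.image r ⊆ B := by
      intro e he
      obtain ⟨i, -, rfl⟩ := Finset.mem_image.1 he
      exact hrB i
    rw [Module.finrank_prod, Module.finrank_fintype_fun_eq_card, hn] at h1
    rw [Finset.card_sdiff_of_subset h3, h2, ← h1]
    omega
  let b : Module.Basis N ℝ V := Module.Basis.mk (v := fun e : N => v e) hliN
    (hliN.span_eq_top_of_card_eq_finrank' (by simp [hcard, hn])).ge
  have hb : ∀ e : N, b e = v e := fun e => Module.Basis.mk_apply _ _ e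
  let enum : Fin n ≃ N := (Finset.equivFinOfCardEq hcard).symm
  refine ⟨fun k => cls (enum k), fun t ht => ?_⟩
  let T : V →ₗ[ℝ] V := Matrix.toLin b b (Matrix.diagonal fun e : N => t (cls e))
  have hT : ∀ e ∈ B, T (v e) = t (cls e) • v e := by
    intro e he
    by_cases heN : e ∈ N
    · rw [← hb ⟨e, heN⟩, Matrix.toLin_self]
      simp [Matrix.diagonal_apply]
    · simp [hvr e he heN]
  have hdet : LinearMap.det T = ∏ k, t (cls (enum k)) := by
    rw [LinearMap.det_toLin, Matrix.det_diagonal, ← Equiv.prod_comp enum]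
  let c : V := ∑ i, pt (r i)
  let c' : V := ∑ i, t i • pt (r i)
  -- Multiplying each weight by the `t` of its colour carries the section at `1` to the section at
  -- `t`. On the differences `v` this acts as the diagonal map `T`; the representatives only
  -- contribute a translation.
  have hslice : slice a B t = (fun x => x + (c' - T c)) '' (T '' slice a B fun _ => 1) := by
    have hpt : ∀ (l : E → ℝ) (s : ι → ℝ) (x : V), ∑ e, l e • a e = (s, x) →
        x = ∑ e, l e • v e + ∑ i, s i • pt (r i) := by
      intro l s x h
      obtain ⟨h1, h2⟩ := sum_weights_eq h
      have h3 : ∑ i, s i • pt (r i) = ∑ e, l e • pt (r (cls e)) := by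
        simp only [← h1, Finset.sum_smul]
        rw [Finset.sum_comm]
        exact Finset.sum_congr rfl fun e _ => by simp [ite_smul]
      rw [h3, ← h2, ← Finset.sum_add_distrib]
      exact Finset.sum_congr rfl fun e _ => by simp [v, smul_sub]
    have hscale : ∀ (u s : ι → ℝ) (l : E → ℝ) (x : V), ∑ e, l e • a e = (s, x) →
        ∑ e, (u (cls e) * l e) • a e = (fun i => u i * s i, ∑ e, (u (cls e) * l e) • pt e) := by
      intro u s l x h
      rw [Prod.ext_iff, Prod.fst_sum, Prod.snd_sum]
      refine ⟨?_, rfl⟩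
      ext i
      change _ = u i * s i
      rw [← (sum_weights_eq h).1 i, Finset.mul_sum, Finset.sum_apply]
      refine Finset.sum_congr rfl fun e _ => ?_
      by_cases hi : cls e = i
      · subst hi; simp [ha, cayley]
      · simp [ha, cayley, hi, Ne.symm hi]
    have key : ∀ (m : E → ℝ) (z : V), m ∈ weights a B (fun _ => 1, z) →
        (fun e => t (cls e) * m e) ∈ weights a B (t, T z + (c' - T c)) := by
      rintro m z ⟨h0, hB, hs⟩
      refine ⟨fun e => mul_nonneg (ht _).le (h0 e), fun e he => by simp [hB e he], ?_⟩
      have h1 := hscale t _ m z hs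
      simp only [mul_one] at h1
      rw [h1]
      congr 1
      rw [hpt _ _ _ h1, hpt _ _ _ hs, map_add, map_sum]
      simp only [one_smul]
      have h2 : ∑ e, T (m e • v e) = ∑ e, (t (cls e) * m e) • v e := by
        refine Finset.sum_congr rfl fun e _ => ?_
        by_cases he : e ∈ B
        · rw [map_smul, hT e he, smul_smul, mul_comm]
        · simp [hB e he]
      rw [h2]
      simp only [c, c']
      abel
    ext x
    simp only [Set.mem_image, exists_exists_and_eq_and]
    constructor
    · rintro ⟨l, h0, hB, hs⟩
      have h1 := hscale (fun i => (t i)⁻¹) _ l x hs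
      have h2 : (fun i => (t i)⁻¹ * t i) = fun _ => 1 := by
        ext i; exact inv_mul_cancel₀ (ht i).ne'
      rw [h2] at h1
      have hm : (fun e => (t (cls e))⁻¹ * l e) ∈ weights a B
          (fun _ => 1, ∑ e, ((t (cls e))⁻¹ * l e) • pt e) :=
        ⟨fun e => mul_nonneg (inv_nonneg.2 (ht _).le) (h0 e), fun e he => by simp [hB e he], h1⟩
      refine ⟨_, ⟨_, hm⟩, ?_⟩
      have h3 := (key _ _ hm).2.2
      simp only [mul_inv_cancel_left₀ (ht _).ne'] at h3
      rw [hs] at h3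
      exact (congrArg Prod.snd h3).symm
    · rintro ⟨z, ⟨m, hm⟩, rfl⟩
      exact ⟨_, key m z hm⟩
  rw [hslice, Set.image_add_right, measure_preimage_add_right, Measure.addHaar_image_linearMap, hdet,
    abs_of_pos (Finset.prod_pos fun k _ => ht _)]

open Classical in
/-- Volumes of Minkowski combinations of polytopes are polynomials whose coefficients are monotone
in the polytopes; here in terms of sections of cones. -/
theorem exists_coeff_slice [FiniteDimensional ℝ V] [MeasurableSpace V] [BorelSpace V]
    (μ : Measure V) [μ.IsAddHaarMeasure] (cls : E → ι) (pt : E → V) {n : ℕ}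
    (hn : Module.finrank ℝ V = n) {D₀ D₁ : Finset E} (hD : D₀ ⊆ D₁) :
    ∃ c₀ c₁ : (Fin n → ι) → ℝ≥0∞, c₀ ≤ c₁ ∧ (∀ J, c₁ J ≠ ⊤) ∧ ∀ t : ι → ℝ, (∀ i, 0 < t i) →
      μ (slice (cayley cls pt) D₀ t) = ∑ J, ENNReal.ofReal (∏ k, t (J k)) * c₀ J ∧
      μ (slice (cayley cls pt) D₁ t) = ∑ J, ENNReal.ofReal (∏ k, t (J k)) * c₁ J := by
  set a := cayley cls pt with ha
  obtain ⟨w, hw, hw'⟩ := exists_isGeneric a D₀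
  have hc : ∀ B : Finset E, ∃ c : (Fin n → ι) → ℝ≥0∞, (∀ J, c J ≠ ⊤) ∧ (IsBasisSet a B →
      ∀ t : ι → ℝ, (∀ i, 0 < t i) →
        μ (slice a B t) = ∑ J, ENNReal.ofReal (∏ k, t (J k)) * c J) := by
    intro B
    by_cases hB : IsBasisSet a B
    · obtain ⟨J, hJ⟩ := exists_measure_slice_eq μ cls pt hn hB
      refine ⟨Pi.single J (μ (slice a B fun _ => 1)), fun J' => ?_, fun _ t ht => ?_⟩
      · by_cases h : J' = J
        · subst h
          simpa using (isCompact_slice cls pt B fun _ => 1).measure_lt_top.ne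
        · simp [h]
      · rw [hJ t ht, Finset.sum_eq_single J]
        · simp [ha]
        · intro J' _ h; simp [h]
        · simp
    · exact ⟨0, by simp, fun h => absurd h hB⟩
  choose c hcfin hc using hc
  have hexp : ∀ (D : Finset E) (t : ι → ℝ), (∀ i, 0 < t i) → μ (slice a D t) =
      ∑ J, ENNReal.ofReal (∏ k, t (J k)) * ∑ B with IsCell a w D B, c B J := by
    intro D t ht
    rw [measure_slice_eq_sum μ ht hw D]
    simp only [Finset.mul_sum]
    rw [Finset.sum_comm]
    refine Finset.sum_congr rfl fun B hB => ?_
    simp only [Finset.mem_filter, Finset.mem_univ, true_and] at hB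
    exact hc B hB.2.1 t ht
  refine ⟨fun J => ∑ B with IsCell a w D₀ B, c B J, fun J => ∑ B with IsCell a w D₁ B, c B J,
    fun J => ?_, fun J => ENNReal.sum_ne_top.2 fun B _ => hcfin B J, fun t ht =>
    ⟨hexp D₀ t ht, hexp D₁ t ht⟩⟩
  -- Every cell over `D₀` is a cell over `D₁` with the same functional, because `hw'` puts the new
  -- points strictly above it.
  refine Finset.sum_le_sum_of_subset fun B hB => ?_
  simp only [Finset.mem_filter, Finset.mem_univ, true_and] at hB ⊢
  obtain ⟨hBD, hbas, y, hy, hlt⟩ := hB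
  refine ⟨hBD.trans hD, hbas, y, hy, fun e _ he => ?_⟩
  by_cases heD : e ∈ D₀
  · exact hlt e heD he
  · exact hw' B hBD hbas y hy e heD

end Coefficients

/-! ### Minkowski combinations of polytopes as sections -/

section Polytopes

variable {ι V : Type*} [Fintype ι] [DecidableEq ι]
  [NormedAddCommGroup V] [NormedSpace ℝ V]

/-- The polytope spanned by a non-empty finite set, as a convex body. -/
def hullBody (s : Finset V) (hs : s.Nonempty) : ConvexBody V where
  carrier := convexHull ℝ (s : Set V)
  convex' := convex_convexHull ℝ _
  isCompact' := s.finite_toSet.isCompact_convexHull ℝ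
  nonempty' := hs.to_set.convexHull

theorem coe_body_sum {κ : Type*} (s : Finset κ) (L : κ → ConvexBody V) :
    ((∑ i ∈ s, L i : ConvexBody V) : Set V) = ∑ i ∈ s, (L i : Set V) := by
  classical
  induction s using Finset.induction_on with
  | empty => simp
  | insert i s hi ih => rw [Finset.sum_insert hi, Finset.sum_insert hi, ConvexBody.coe_add, ih]

theorem sum_subtype_ite_mem {M : Type*} [AddCommMonoid M] {A B : Finset V} (h : A ⊆ B)
    [DecidablePred (· ∈ A)] (f : V → M) :
    (∑ v : B, if (v : V) ∈ A then f v else 0) = ∑ v ∈ A, f v := by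
  rw [Finset.sum_coe_sort B (fun v => if v ∈ A then f v else 0), ← Finset.sum_filter]
  congr 1
  ext v
  simpa using fun hv => h hv

/-- The weights of colour `i` sum to `t i`, so division by `t i` gives convex combinations. Indexing
by the larger sets `W i` lets two nested families share one embedding. -/
theorem slice_eq_sum_smul_convexHull (U W : ι → Finset V) (hUW : ∀ i, U i ⊆ W i) (t : ι → ℝ)
    (ht : ∀ i, 0 < t i) [DecidablePred fun e : Σ i, W i => (e.2 : V) ∈ U e.1] :
    slice (cayley (Sigma.fst : (Σ i, W i) → ι) fun e => (e.2 : V))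
      (Finset.univ.filter fun e => (e.2 : V) ∈ U e.1) t =
      ∑ i, t i • convexHull ℝ (U i : Set V) := by
  classical
  ext x
  rw [Set.mem_fintype_sum]
  constructor
  · rintro ⟨l, h0, hD, hs⟩
    obtain ⟨h1, h2⟩ := sum_weights_eq hs
    simp only [Fintype.sum_sigma] at h1 h2
    refine ⟨fun i => ∑ v : W i, l ⟨i, v⟩ • (v : V), fun i => ?_, h2⟩
    rw [Set.mem_smul_set]
    refine ⟨(t i)⁻¹ • ∑ v : W i, l ⟨i, v⟩ • (v : V), ?_, smul_inv_smul₀ (ht i).ne' _⟩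
    let w : V → ℝ := fun v => if h : v ∈ W i then (t i)⁻¹ * l ⟨i, v, h⟩ else 0
    have hw : ∀ v : W i, w v = (t i)⁻¹ * l ⟨i, v⟩ := fun v => by simp [w]
    have hw0 : ∀ v ∈ W i, v ∉ U i → w v = 0 := fun v hv hvU => by
      rw [hw ⟨v, hv⟩, hD _ (by simpa using hvU), mul_zero]
    have hti : ∑ v : W i, l ⟨i, v⟩ = t i := by
      rw [← h1 i, Finset.sum_eq_single i]
      · simp
      · intro j _ hj; simp [hj]
      · simp
    rw [Finset.mem_convexHull']
    refine ⟨w, fun v hv => ?_, ?_, ?_⟩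
    · rw [hw ⟨v, hUW i hv⟩]
      exact mul_nonneg (inv_nonneg.2 (ht i).le) (h0 _)
    · rw [Finset.sum_subset (hUW i) hw0, ← Finset.sum_coe_sort]
      simp only [hw, ← Finset.mul_sum, hti]
      exact inv_mul_cancel₀ (ht i).ne'
    · rw [Finset.sum_subset (hUW i) fun v hv hvU => by rw [hw0 v hv hvU, zero_smul],
        ← Finset.sum_coe_sort]
      simp only [hw, Finset.smul_sum, smul_smul]
  · rintro ⟨g, hg, rfl⟩
    have hg' : ∀ i, ∃ w : V → ℝ, (∀ v ∈ U i, 0 ≤ w v) ∧ ∑ v ∈ U i, w v = 1 ∧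
        t i • ∑ v ∈ U i, w v • v = g i := by
      intro i
      obtain ⟨y, hy, hyg⟩ := Set.mem_smul_set.1 (hg i)
      obtain ⟨w, h1, h2, h3⟩ := Finset.mem_convexHull'.1 hy
      exact ⟨w, h1, h2, by rw [h3, hyg]⟩
    choose w hw0 hw1 hwg using hg'
    refine ⟨fun e => if (e.2 : V) ∈ U e.1 then t e.1 * w e.1 e.2 else 0, fun e => ?_,
      fun e he => ?_, ?_⟩
    · dsimp only
      split_ifs with h
      · exact mul_nonneg (ht _).le (hw0 _ _ h)
      · exact le_rfl
    · have : (e.2 : V) ∉ U e.1 := by simpa using he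
      simp [this]
    rw [Prod.ext_iff, Prod.fst_sum, Prod.snd_sum]
    constructor
    · ext i
      rw [Finset.sum_apply, Fintype.sum_sigma, Finset.sum_eq_single i]
      · simp only [cayley, Prod.smul_mk, Pi.smul_apply, Pi.single_eq_same, smul_eq_mul, mul_one]
        rw [sum_subtype_ite_mem (hUW i) fun v => t i * w i v, ← Finset.mul_sum, hw1, mul_one]
      · intro j _ hj
        exact Finset.sum_eq_zero fun v _ => by
          simp only [cayley, Prod.smul_mk, Pi.smul_apply]
          simp [hj.symm]
      · simp
    · rw [Fintype.sum_sigma]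
      refine Finset.sum_congr rfl fun i _ => ?_
      simp only [cayley, Prod.smul_mk]
      simp only [ite_smul, zero_smul]
      rw [sum_subtype_ite_mem (hUW i) fun v => (t i * w i v) • v, ← hwg i, Finset.smul_sum]
      simp only [smul_smul]

/-- The volume of a Minkowski combination of polytopes is a polynomial with non-negative
coefficients, which can be chosen to increase with the polytopes. -/
theorem exists_coeff_convexHull [FiniteDimensional ℝ V] [MeasurableSpace V] [BorelSpace V]
    (μ : Measure V) [μ.IsAddHaarMeasure] {n : ℕ} (hn : Module.finrank ℝ V = n)
    (U W : ι → Finset V) (hUW : ∀ i, U i ⊆ W i) :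
    ∃ c₀ c₁ : (Fin n → ι) → ℝ≥0∞, c₀ ≤ c₁ ∧ (∀ J, c₁ J ≠ ⊤) ∧ ∀ t : ι → ℝ, (∀ i, 0 < t i) →
      μ (∑ i, t i • convexHull ℝ (U i : Set V)) = ∑ J, ENNReal.ofReal (∏ k, t (J k)) * c₀ J ∧
      μ (∑ i, t i • convexHull ℝ (W i : Set V)) = ∑ J, ENNReal.ofReal (∏ k, t (J k)) * c₁ J := by
  classical
  obtain ⟨c₀, c₁, hle, hfin, h⟩ := exists_coeff_slice μ (Sigma.fst : (Σ i, W i) → ι)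
    (fun e => (e.2 : V)) hn (D₀ := Finset.univ.filter fun e => (e.2 : V) ∈ U e.1)
    (D₁ := Finset.univ.filter fun e => (e.2 : V) ∈ W e.1) (fun e _ => by simp)
  refine ⟨c₀, c₁, hle, hfin, fun t ht => ?_⟩
  rw [← slice_eq_sum_smul_convexHull U W hUW t ht,
    ← slice_eq_sum_smul_convexHull W W (fun _ => subset_rfl) t ht]
  exact h t ht

theorem isCompact_sum_smul_body (L : ι → ConvexBody V) (t : ι → ℝ) :
    IsCompact (∑ i, t i • (L i : Set V)) := by
  have : (∑ i, t i • (L i : Set V)) = ((∑ i, t i • L i : ConvexBody V) : Set V) := by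
    rw [coe_body_sum]; simp
  rw [this]
  exact ConvexBody.isCompact _

/-- A polynomial expansion of the volume of Minkowski combinations with positive coefficients
extends to non-negative coefficients. -/
theorem measure_sum_smul_of_nonneg [FiniteDimensional ℝ V] [MeasurableSpace V] [BorelSpace V]
    (μ : Measure V) [μ.IsAddHaarMeasure] {n : ℕ} (L : ι → ConvexBody V)
    (c : (Fin n → ι) → ℝ≥0∞) (hc : ∀ J, c J ≠ ⊤)
    (h : ∀ t : ι → ℝ, (∀ i, 0 < t i) →
      μ (∑ i, t i • (L i : Set V)) = ∑ J, ENNReal.ofReal (∏ k, t (J k)) * c J)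
    (t : ι → ℝ) (ht : ∀ i, 0 ≤ t i) :
    μ (∑ i, t i • (L i : Set V)) = ∑ J, ENNReal.ofReal (∏ k, t (J k)) * c J := by
  set A : Set V := ∑ i, t i • (L i : Set V) with hA
  set Q : Set V := ∑ i, (L i : Set V) with hQ
  have hAc : IsCompact A := isCompact_sum_smul_body L t
  have hQc : IsCompact Q := by simpa using isCompact_sum_smul_body L fun _ => 1
  have hQne : Q.Nonempty := by
    rw [hQ, ← coe_body_sum]; exact ConvexBody.nonempty _
  have hsum : ∀ s : ℝ, 0 < s → ∑ i, (t i + s) • (L i : Set V) = A + s • Q := by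
    intro s hs
    rw [hA, hQ, Finset.smul_sum, ← Finset.sum_add_distrib]
    exact Finset.sum_congr rfl fun i _ => (L i).convex.add_smul (ht i) hs.le
  have hr : Filter.Tendsto (fun s : ℝ => ∑ J, ENNReal.ofReal (∏ k, (t (J k) + s)) * c J)
      (nhdsWithin 0 (Set.Ioi 0)) (nhds (∑ J, ENNReal.ofReal (∏ k, t (J k)) * c J)) := by
    refine tendsto_finsetSum _ fun J _ => ENNReal.Tendsto.mul_const ?_ (Or.inr (hc J))
    have hcont : Continuous fun s : ℝ => ENNReal.ofReal (∏ k, (t (J k) + s)) :=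
      ENNReal.continuous_ofReal.comp (by fun_prop)
    simpa using (hcont.tendsto 0).mono_left nhdsWithin_le_nhds
  obtain ⟨R, hR⟩ := hQc.isBounded.subset_closedBall 0
  -- `A + s • Q` contains a translate of `A` and lies in the thickening of `A` by `s * R`, so its
  -- measure is squeezed.
  have hl : Filter.Tendsto (fun s : ℝ => μ (A + s • Q)) (nhdsWithin 0 (Set.Ioi 0))
      (nhds (μ A)) := by
    have hth : Filter.Tendsto (fun s : ℝ => μ (Metric.cthickening (s * R) A))
        (nhdsWithin 0 (Set.Ioi 0)) (nhds (μ A)) := by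
      refine (tendsto_measure_cthickening_of_isCompact hAc).comp ?_
      have : Continuous fun s : ℝ => s * R := by fun_prop
      simpa using (this.tendsto 0).mono_left nhdsWithin_le_nhds
    refine tendsto_of_tendsto_of_tendsto_of_le_of_le' tendsto_const_nhds hth ?_ ?_
    · obtain ⟨q, hq⟩ := hQne
      refine Filter.Eventually.of_forall fun s => ?_
      calc μ A = μ ((fun x => x + s • q) '' A) := by
            rw [Set.image_add_right, measure_preimage_add_right]
        _ ≤ μ (A + s • Q) := by
            refine measure_mono ?_
            rintro _ ⟨x, hx, rfl⟩
            exact Set.add_mem_add hx (Set.smul_mem_smul_set hq)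
    · filter_upwards [eventually_mem_nhdsWithin] with s hs
      refine measure_mono ?_
      rintro _ ⟨x, hx, _, ⟨q, hq, rfl⟩, rfl⟩
      refine Metric.mem_cthickening_of_dist_le _ x _ _ hx ?_
      have hqR : ‖q‖ ≤ R := by simpa using hR hq
      change dist (x + s • q) x ≤ s * R
      rw [dist_eq_norm, add_sub_cancel_left, norm_smul, Real.norm_eq_abs,
        abs_of_pos (Set.mem_Ioi.1 hs)]
      exact mul_le_mul_of_nonneg_left hqR (le_of_lt hs)
  refine tendsto_nhds_unique hl (hr.congr' ?_)
  filter_upwards [eventually_mem_nhdsWithin] with s hs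
  rw [← hsum s hs, h _ fun i => add_pos_of_nonneg_of_pos (ht i) hs]

end Polytopes

/-! ### The polarization identity -/

section Polarization

/-- The complements of the sets `S` that contain the range of `θ` are the subsets of the complement
of the range. Their alternating sum vanishes unless that complement is empty. -/
theorem sum_neg_one_pow_of_forall_mem {n : ℕ} (θ : Fin n → Fin n) :
    (∑ S : Finset (Fin n), if ∀ k, θ k ∈ S then (-1 : ℝ) ^ (n - S.card) else 0) =
      if Function.Bijective θ then 1 else 0 := by
  classical
  rw [← Equiv.sum_comp (compl_involutive (α := Finset (Fin n))).toPerm]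
  simp only [Function.Involutive.coe_toPerm]
  have h1 : ∀ T : Finset (Fin n), (∀ k, θ k ∈ Tᶜ) ↔
      T ∈ (Finset.univ.filter fun a => a ∉ Set.range θ).powerset := by
    intro T
    simp only [Finset.mem_compl, Finset.mem_powerset]
    constructor
    · intro h a ha
      simp only [Finset.mem_filter, Finset.mem_univ, true_and]
      rintro ⟨k, rfl⟩
      exact h k ha
    · intro h k hk
      have := h hk
      simp at this
      exact this k rfl
  simp only [h1]
  rw [← Finset.sum_filter, Finset.filter_mem_eq_inter, Finset.univ_inter]
  have h2 : ∀ T : Finset (Fin n), n - Tᶜ.card = T.card := by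
    intro T
    rw [Finset.card_compl, Fintype.card_fin]
    have := card_finset_fin_le T
    omega
  simp only [h2]
  have h3 := congrArg (Int.cast : ℤ → ℝ) (Finset.sum_powerset_neg_one_pow_card
    (x := Finset.univ.filter fun a => a ∉ Set.range θ))
  push_cast at h3
  rw [h3]
  congr 1
  rw [← Finite.surjective_iff_bijective]
  simp [Finset.filter_eq_empty_iff, Function.Surjective]

/-- The product of sums counts the maps `θ` into `S` with `I ∘ θ = J`. Summing over `S` with signs
leaves only the bijective `θ`. -/
theorem polarization {ι : Type*} [Fintype ι] [DecidableEq ι] {n : ℕ} (c : (Fin n → ι) → ℝ)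
    (I : Fin n → ι) :
    ∑ S : Finset (Fin n), (-1 : ℝ) ^ (n - S.card) *
      ∑ J : Fin n → ι, (∏ k, ∑ j ∈ S, if I j = J k then (1 : ℝ) else 0) * c J =
      ∑ σ : Equiv.Perm (Fin n), c (I ∘ σ) := by
  classical
  have h1 : ∀ S : Finset (Fin n),
      ∑ J : Fin n → ι, (∏ k, ∑ j ∈ S, if I j = J k then (1 : ℝ) else 0) * c J =
      ∑ θ : Fin n → Fin n, if ∀ k, θ k ∈ S then c (I ∘ θ) else 0 := by
    intro S
    simp only [Finset.prod_univ_sum, Finset.sum_mul]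
    rw [Finset.sum_comm, ← Finset.sum_filter]
    refine Finset.sum_congr (by ext; simp [Fintype.mem_piFinset]) fun θ _ => ?_
    rw [Finset.sum_eq_single (I ∘ θ)]
    · simp
    · intro J _ hJ
      have : ∃ k, I (θ k) ≠ J k := by
        by_contra! h
        exact hJ (funext fun k => (h k).symm)
      obtain ⟨k, hk⟩ := this
      rw [Finset.prod_eq_zero (Finset.mem_univ k) (if_neg hk), zero_mul]
    · simp
  simp only [h1, Finset.mul_sum]
  rw [Finset.sum_comm]
  have h2 : ∀ θ : Fin n → Fin n, (∑ S : Finset (Fin n), (-1 : ℝ) ^ (n - S.card) *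
      if ∀ k, θ k ∈ S then c (I ∘ θ) else 0) =
      if Function.Bijective θ then c (I ∘ θ) else 0 := by
    intro θ
    have := congrArg (· * c (I ∘ θ)) (sum_neg_one_pow_of_forall_mem θ)
    simp only [Finset.sum_mul, ite_mul, zero_mul, one_mul] at this
    rw [← this]
    exact Finset.sum_congr rfl fun S _ => by split_ifs <;> simp
  simp only [h2]
  symm
  refine Finset.sum_of_injOn (fun σ : Equiv.Perm (Fin n) => (σ : Fin n → Fin n)) ?_ ?_ ?_ ?_
  · exact fun σ _ τ _ h => DFunLike.coe_injective h
  · simp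
  · intro θ _ hθ
    rw [if_neg]
    intro hb
    exact hθ ⟨Equiv.ofBijective θ hb, by simp, rfl⟩
  · intro σ _
    rw [if_pos σ.bijective]

end Polarization

/-! ### Mixed volumes of polytopes -/

section MixedVolume

variable {ι : Type*} [Fintype ι] [DecidableEq ι] {n : ℕ}

/-- The partial sum over `S` is the combination in which `L i` has coefficient the number of `j ∈ S`
with `I j = i`. Some of these vanish, so the expansion is needed for non-negative coefficients too.
-/
theorem bodyMixedVolume_comp_eq (L : ι → ConvexBody (EuclideanSpace ℝ (Fin n)))
    (c : (Fin n → ι) → ℝ≥0∞) (hc : ∀ J, c J ≠ ⊤)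
    (h : ∀ t : ι → ℝ, (∀ i, 0 < t i) →
      volume (∑ i, t i • (L i : Set (EuclideanSpace ℝ (Fin n)))) =
        ∑ J, ENNReal.ofReal (∏ k, t (J k)) * c J) (I : Fin n → ι) :
    bodyMixedVolume (fun k => L (I k)) =
      (n ! : ℝ)⁻¹ * ∑ σ : Equiv.Perm (Fin n), (c (I ∘ σ)).toReal := by
  rw [bodyMixedVolume, ← polarization (fun J => (c J).toReal) I]
  congr 1
  refine Finset.sum_congr rfl fun S _ => ?_
  congr 1
  have h1 : ((∑ j ∈ S, L (I j) : ConvexBody (EuclideanSpace ℝ (Fin n))) :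
      Set (EuclideanSpace ℝ (Fin n))) =
      ∑ i, (∑ j ∈ S, if I j = i then (1 : ℝ) else 0) • (L i : Set (EuclideanSpace ℝ (Fin n))) := by
    rw [coe_body_sum]
    induction S using Finset.induction_on with
    | empty => simp [(L _).nonempty]
    | insert j S hj ih =>
      rw [Finset.sum_insert hj, ih (Finset.mem_univ S)]
      have h2 : (L (I j) : Set (EuclideanSpace ℝ (Fin n))) =
          ∑ i, (if I j = i then (1 : ℝ) else 0) • (L i : Set (EuclideanSpace ℝ (Fin n))) := by
        rw [Finset.sum_eq_single (I j)]
        · simp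
        · intro i _ hi; simp [hi.symm, (L i).nonempty]
        · simp
      rw [h2, ← Finset.sum_add_distrib]
      refine Finset.sum_congr rfl fun i _ => ?_
      rw [Finset.sum_insert hj, (L i).convex.add_smul (by split_ifs <;> norm_num)
        (Finset.sum_nonneg fun j _ => by split_ifs <;> norm_num)]
  have hnn : ∀ i, 0 ≤ ∑ j ∈ S, if I j = i then (1 : ℝ) else 0 := fun i =>
    Finset.sum_nonneg fun j _ => by split_ifs <;> norm_num
  rw [h1, measure_sum_smul_of_nonneg volume L c hc h _ hnn, ENNReal.toReal_sum]
  · refine Finset.sum_congr rfl fun J _ => ?_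
    rw [ENNReal.toReal_mul, ENNReal.toReal_ofReal (Finset.prod_nonneg fun k _ => hnn _)]
  · exact fun J _ => ENNReal.mul_ne_top ENNReal.ofReal_ne_top (hc J)

/-- Mixed volumes are averages of the coefficients of the two compatible subdivisions, which compare
term by term. -/
theorem bodyMixedVolume_hullBody_mono {U W : Fin n → Finset (EuclideanSpace ℝ (Fin n))}
    (hU : ∀ i, (U i).Nonempty) (hW : ∀ i, (W i).Nonempty) (hUW : ∀ i, U i ⊆ W i) :
    bodyMixedVolume (fun k => hullBody (U k) (hU k)) ≤
      bodyMixedVolume (fun k => hullBody (W k) (hW k)) := by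
  obtain ⟨c₀, c₁, hle, hfin, h⟩ := exists_coeff_convexHull
    (volume : Measure (EuclideanSpace ℝ (Fin n))) finrank_euclideanSpace_fin U W hUW
  have h0 := bodyMixedVolume_comp_eq (fun k => hullBody (U k) (hU k)) c₀
    (fun J => ne_top_of_le_ne_top (hfin J) (hle J)) (fun t ht => (h t ht).1) id
  have h1 := bodyMixedVolume_comp_eq (fun k => hullBody (W k) (hW k)) c₁ hfin
    (fun t ht => (h t ht).2) id
  simp only [id_eq] at h0 h1
  rw [h0, h1]
  refine mul_le_mul_of_nonneg_left (Finset.sum_le_sum fun σ _ => ?_) (by positivity)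
  exact ENNReal.toReal_mono (hfin _) (hle _)

/-- Minkowski's expansion of the volume, for polytopes. -/
theorem volume_sum_smul_convexHull (U : ι → Finset (EuclideanSpace ℝ (Fin n)))
    (hU : ∀ i, (U i).Nonempty) (ε : ι → ℝ) (hε : ∀ i, 0 < ε i) :
    volume (∑ i, ε i • convexHull ℝ (U i : Set (EuclideanSpace ℝ (Fin n)))) =
      ∑ I : Fin n → ι, ENNReal.ofReal (∏ k, ε (I k)) *
        ENNReal.ofReal (bodyMixedVolume fun k => hullBody (U (I k)) (hU (I k))) := by
  obtain ⟨c, c', hle, hfin', h⟩ := exists_coeff_convexHull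
    (volume : Measure (EuclideanSpace ℝ (Fin n))) finrank_euclideanSpace_fin U U
    fun _ => subset_rfl
  have hfin := fun J => ne_top_of_le_ne_top (hfin' J) (hle J)
  have hV := bodyMixedVolume_comp_eq (fun i => hullBody (U i) (hU i)) c hfin
    (fun t ht => (h t ht).1)
  have hpos : ∀ I : Fin n → ι, 0 ≤ ∏ k, ε (I k) := fun I =>
    Finset.prod_nonneg fun k _ => (hε _).le
  have hVpos : ∀ I : Fin n → ι,
      0 ≤ bodyMixedVolume fun k => hullBody (U (I k)) (hU (I k)) := fun I => by
    rw [hV I]; positivity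
  -- Monomials are invariant under permuting the factors, so symmetrizing the coefficients does not
  -- change the polynomial.
  have key : ∑ I : Fin n → ι, (∏ k, ε (I k)) *
      (bodyMixedVolume fun k => hullBody (U (I k)) (hU (I k))) =
      ∑ I : Fin n → ι, (∏ k, ε (I k)) * (c I).toReal := by
    have h1 : ∀ σ : Equiv.Perm (Fin n), ∑ I : Fin n → ι, (∏ k, ε (I k)) * (c (I ∘ σ)).toReal =
        ∑ I : Fin n → ι, (∏ k, ε (I k)) * (c I).toReal := by
      intro σ
      refine Fintype.sum_equiv (Equiv.arrowCongr σ.symm (Equiv.refl ι)) _ _ fun I => ?_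
      have h2 : (Equiv.arrowCongr σ.symm (Equiv.refl ι)) I = I ∘ σ := rfl
      rw [h2, ← Equiv.prod_comp σ fun k => ε (I k)]
      rfl
    simp only [hV, Finset.mul_sum]
    rw [Finset.sum_comm]
    simp only [mul_left_comm _ (n ! : ℝ)⁻¹, ← Finset.mul_sum, h1]
    rw [Finset.sum_const, Finset.card_univ, Fintype.card_perm, Fintype.card_fin, nsmul_eq_mul,
      inv_mul_cancel_left₀ (by positivity)]
  rw [(h ε hε).1]
  have h3 : ∀ I, c I = ENNReal.ofReal (c I).toReal := fun I => (ENNReal.ofReal_toReal (hfin I)).symm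
  conv_lhs => enter [2, I]; rw [h3 I, ← ENNReal.ofReal_mul (hpos I)]
  conv_rhs => enter [2, I]; rw [← ENNReal.ofReal_mul (hpos I)]
  rw [← ENNReal.ofReal_sum_of_nonneg, ← ENNReal.ofReal_sum_of_nonneg, key]
  · exact fun I _ => mul_nonneg (hpos I) (hVpos I)
  · exact fun I _ => mul_nonneg (hpos I) ENNReal.toReal_nonneg

end MixedVolume

/-! ### From polytopes to convex sets -/

section Approximation

variable {ι V : Type*} [Fintype ι] [DecidableEq ι] [NormedAddCommGroup V] [NormedSpace ℝ V]

/-- Families of non-empty finite subsets of the sets `A i`, ordered by inclusion. -/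
def FinsetFamily (A : ι → Set V) : Type _ :=
  {U : ι → Finset V // ∀ i, (U i).Nonempty ∧ (U i : Set V) ⊆ A i}

instance (A : ι → Set V) : PartialOrder (FinsetFamily A) :=
  inferInstanceAs (PartialOrder {U : ι → Finset V // ∀ i, (U i).Nonempty ∧ (U i : Set V) ⊆ A i})

instance (A : ι → Set V) : IsDirectedOrder (FinsetFamily A) where
  directed U W := by
    classical
    refine ⟨⟨fun i => U.1 i ∪ W.1 i, fun i => ⟨(U.2 i).1.mono Finset.subset_union_left, ?_⟩⟩,
      fun i => Finset.subset_union_left, fun i => Finset.subset_union_right⟩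
    rw [Finset.coe_union]
    exact Set.union_subset (U.2 i).2 (W.2 i).2

theorem FinsetFamily.nonempty {A : ι → Set V} (hA : ∀ i, (A i).Nonempty) :
    Nonempty (FinsetFamily A) := by
  choose x hx using hA
  exact ⟨⟨fun i => {x i}, fun i => ⟨Finset.singleton_nonempty _, by simpa using hx i⟩⟩⟩

/-- The polytopes spanned by a family of finite sets. -/
def FinsetFamily.hull {A : ι → Set V} (U : FinsetFamily A) (i : ι) : ConvexBody V :=
  hullBody (U.1 i) (U.2 i).1

theorem FinsetFamily.hull_subset {A : ι → Set V} (hA : ∀ i, Convex ℝ (A i)) (U : FinsetFamily A)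
    (i : ι) : (U.hull i : Set V) ⊆ A i :=
  convexHull_min (U.2 i).2 (hA i)

theorem FinsetFamily.hull_mono {A : ι → Set V} {U W : FinsetFamily A} (h : U ≤ W) (i : ι) :
    (U.hull i : Set V) ⊆ W.hull i :=
  convexHull_mono (Finset.coe_subset.2 (h i))

theorem sum_smul_subset {A B : ι → Set V} (h : ∀ i, A i ⊆ B i) (t : ι → ℝ) :
    ∑ i, t i • A i ⊆ ∑ i, t i • B i := by
  intro x hx
  rw [Set.mem_fintype_sum] at hx ⊢
  obtain ⟨g, hg, rfl⟩ := hx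
  exact ⟨g, fun i => Set.smul_set_mono (h i) (hg i), rfl⟩

theorem convex_sum_smul {A : ι → Set V} (hA : ∀ i, Convex ℝ (A i)) (t : ι → ℝ) :
    Convex ℝ (∑ i, t i • A i) :=
  convex_sum _ fun i _ => (hA i).smul (t i)

/-- A convex set is exhausted in measure by polytopes. -/
theorem exists_finset_lt_measure_convexHull [FiniteDimensional ℝ V] [MeasurableSpace V]
    [BorelSpace V] (μ : Measure V) [μ.IsAddHaarMeasure] {C : Set V} (hC : Convex ℝ C) {r : ℝ≥0∞}
    (hr : r < μ C) : ∃ u : Finset V, (u : Set V) ⊆ C ∧ r < μ (convexHull ℝ (u : Set V)) := by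
  -- The frontier of a convex set is null, so a compact subset of the interior can carry the
  -- measure.
  have hint : μ C ≤ μ (interior C) := by
    calc μ C ≤ μ (interior C ∪ frontier C) := by
          refine measure_mono ?_
          rw [← closure_eq_interior_union_frontier]
          exact subset_closure
      _ ≤ μ (interior C) + μ (frontier C) := measure_union_le _ _
      _ = μ (interior C) := by rw [hC.addHaar_frontier μ, add_zero]
  obtain ⟨K, hKC, hK, hrK⟩ := isOpen_interior.exists_lt_isCompact (hr.trans_le hint)
  -- Each point of `K` is interior to a simplex inside `C`; finitely many such simplices cover `K`.
  have hcov : ∃ u : Finset V, (u : Set V) ⊆ C ∧ K ⊆ convexHull ℝ (u : Set V) := by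
    refine hK.induction_on (p := fun s => ∃ u : Finset V, (u : Set V) ⊆ C ∧
      s ⊆ convexHull ℝ (u : Set V)) ⟨∅, by simp, by simp⟩
      (fun s s' hs ⟨u, hu, h⟩ => ⟨u, hu, hs.trans h⟩) ?_ fun x hx => ?_
    · rintro s s' ⟨u, hu, h⟩ ⟨u', hu', h'⟩
      classical
      refine ⟨u ∪ u', by simpa using ⟨hu, hu'⟩, Set.union_subset (h.trans (convexHull_mono ?_))
        (h'.trans (convexHull_mono ?_))⟩ <;> simp
    · obtain ⟨b, hb, hbC⟩ := exists_mem_interior_convexHull_affineBasis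
        (isOpen_interior.mem_nhds (hKC hx))
      classical
      refine ⟨_, mem_nhdsWithin_of_mem_nhds (mem_interior_iff_mem_nhds.1 hb),
        Finset.univ.image b, ?_, by simp⟩
      simpa using (subset_convexHull ℝ (Set.range b)).trans (hbC.trans interior_subset)
  obtain ⟨u, huC, hKu⟩ := hcov
  exact ⟨u, huC, hrK.trans_le (measure_mono hKu)⟩

/-- Each vertex of a polytope inscribed in the sum splits into points of the `A i`. Collecting these
points gives polytopes whose combination contains the inscribed one; `x i` is inserted only to keep
each set non-empty. -/
theorem measure_sum_smul_eq_iSup [FiniteDimensional ℝ V] [MeasurableSpace V] [BorelSpace V]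
    (μ : Measure V) [μ.IsAddHaarMeasure] {A : ι → Set V} (hA : ∀ i, Convex ℝ (A i))
    (hne : ∀ i, (A i).Nonempty) (t : ι → ℝ) :
    μ (∑ i, t i • A i) = ⨆ U : FinsetFamily A, μ (∑ i, t i • (U.hull i : Set V)) := by
  classical
  refine le_antisymm (le_of_forall_lt fun r hr => ?_)
    (iSup_le fun U => measure_mono (sum_smul_subset (U.hull_subset hA) t))
  obtain ⟨u, huC, hru⟩ := exists_finset_lt_measure_convexHull μ (convex_sum_smul hA t) hr
  have hg : ∀ p : u, ∃ g : ι → V, (∀ i, g i ∈ A i) ∧ ∑ i, t i • g i = p := by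
    intro p
    obtain ⟨g, hg, hgp⟩ := (Set.mem_fintype_sum _ _).1 (huC p.2)
    choose g' hg' hgg' using fun i => Set.mem_smul_set.1 (hg i)
    exact ⟨g', hg', by rw [← hgp]; exact Finset.sum_congr rfl fun i _ => hgg' i⟩
  choose g hgA hgp using hg
  choose x hx using hne
  let U : FinsetFamily A := ⟨fun i => insert (x i) (Finset.univ.image fun p => g p i), fun i =>
    ⟨Finset.insert_nonempty _ _, by
      intro y hy
      rw [Finset.mem_coe, Finset.mem_insert, Finset.mem_image] at hy
      rcases hy with rfl | ⟨p, -, rfl⟩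
      · exact hx i
      · exact hgA p i⟩⟩
  refine lt_iSup_iff.2 ⟨U, hru.trans_le (measure_mono (convexHull_min ?_
    (convex_sum_smul (fun i => (U.hull i).convex) t)))⟩
  intro p hp
  rw [Set.mem_fintype_sum]
  refine ⟨_, fun i => Set.smul_mem_smul_set (subset_convexHull ℝ _ ?_), hgp ⟨p, hp⟩⟩
  exact Finset.mem_insert_of_mem (Finset.mem_image_of_mem (fun p => g p i) (Finset.mem_univ _))

theorem sum_indicator_smul {K : ι → Set V} (hK : ∀ i, (K i).Nonempty) (S : Finset ι) :
    ∑ i, (if i ∈ S then (1 : ℝ) else 0) • K i = ∑ i ∈ S, K i := by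
  rw [← Finset.sum_subset (Finset.subset_univ S) fun i _ hi => by simp [hi, Set.zero_smul_set (hK i)]]
  exact Finset.sum_congr rfl fun i hi => by simp [hi]

/-- The alternating signs rule out a direct supremum. Instead, each volume in the sum converges,
being monotone along the directed family with a finite supremum. -/
theorem tendsto_bodyMixedVolume_hull {n : ℕ} (L : Fin n → ConvexBody (EuclideanSpace ℝ (Fin n))) :
    Filter.Tendsto (fun U : FinsetFamily fun k => (L k : Set (EuclideanSpace ℝ (Fin n))) =>
      bodyMixedVolume U.hull) Filter.atTop (nhds (bodyMixedVolume L)) := by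
  unfold bodyMixedVolume
  refine tendsto_const_nhds.mul (tendsto_finsetSum _ fun S _ => tendsto_const_nhds.mul ?_)
  refine (ENNReal.tendsto_toReal (ConvexBody.isCompact _).measure_lt_top.ne).comp ?_
  simp only [coe_body_sum]
  rw [← sum_indicator_smul (fun k => (L k).nonempty), measure_sum_smul_eq_iSup volume
    (fun k => (L k).convex) (fun k => (L k).nonempty)]
  have hmono : Monotone fun U : FinsetFamily fun k => (L k : Set (EuclideanSpace ℝ (Fin n))) =>
      volume (∑ i, (if i ∈ S then (1 : ℝ) else 0) • (U.hull i : Set (EuclideanSpace ℝ (Fin n)))) :=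
    fun U W h => measure_mono (sum_smul_subset (FinsetFamily.hull_mono h) _)
  refine (tendsto_atTop_iSup hmono).congr fun U => ?_
  rw [sum_indicator_smul fun k => (U.hull k).nonempty]

/-- Bodies `L k` with the same index `I k` may differ, so polytopes inscribed in them are merged
into one polytope per index; monotonicity for polytopes absorbs the enlargement. -/
theorem iSup_bodyMixedVolume_hull {n : ℕ} {A : ι → Set (EuclideanSpace ℝ (Fin n))}
    (hA : ∀ i, Convex ℝ (A i)) (hne : ∀ i, (A i).Nonempty) (I : Fin n → ι) :
    ⨆ U : FinsetFamily A, ENNReal.ofReal (bodyMixedVolume fun k => U.hull (I k)) =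
      mixedVolume fun k => A (I k) := by
  classical
  refine le_antisymm (iSup_le fun U => le_iSup₂_of_le (fun k => U.hull (I k))
    (fun k => U.hull_subset hA (I k)) le_rfl) (iSup₂_le fun L hL => ?_)
  choose x hx using hne
  have := FinsetFamily.nonempty fun k => (L k).nonempty
  have hlim := (ENNReal.continuous_ofReal.tendsto _).comp (tendsto_bodyMixedVolume_hull L)
  refine le_of_tendsto' hlim fun W => ?_
  let U : FinsetFamily A := ⟨fun i => insert (x i) (Finset.univ.biUnion fun k =>
    if I k = i then W.1 k else ∅), fun i => ⟨Finset.insert_nonempty _ _, by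
      intro y hy
      rw [Finset.mem_coe, Finset.mem_insert, Finset.mem_biUnion] at hy
      rcases hy with rfl | ⟨k, -, hk⟩
      · exact hx i
      · split_ifs at hk with h
        · exact h ▸ hL k ((W.2 k).2 hk)
        · simp at hk⟩⟩
  refine le_iSup_of_le U (ENNReal.ofReal_le_ofReal ?_)
  refine bodyMixedVolume_hullBody_mono (fun k => (W.2 k).1) (fun k => (U.2 (I k)).1) fun k y hy => ?_
  exact Finset.mem_insert_of_mem (Finset.mem_biUnion.2 ⟨k, Finset.mem_univ k, by simpa using hy⟩)

/-- Take suprema over inscribed polytopes on both sides of the polytope case; monotonicity and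
directedness let the supremum pass through the finite sum. -/
theorem volume_sum_smul_eq_mixedVolume {n : ℕ} {A : ι → Set (EuclideanSpace ℝ (Fin n))}
    (hA : ∀ i, Convex ℝ (A i)) (hne : ∀ i, (A i).Nonempty) {ε : ι → ℝ} (hε : ∀ i, 0 < ε i) :
    volume (∑ i, ε i • A i) =
      ∑ I : Fin n → ι, ENNReal.ofReal (∏ k, ε (I k)) * mixedVolume fun k => A (I k) := by
  rw [measure_sum_smul_eq_iSup volume hA hne]
  have h1 : ∀ U : FinsetFamily A,
      volume (∑ i, ε i • (U.hull i : Set (EuclideanSpace ℝ (Fin n)))) =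
      ∑ I : Fin n → ι, ENNReal.ofReal (∏ k, ε (I k)) *
        ENNReal.ofReal (bodyMixedVolume fun k => U.hull (I k)) := fun U =>
    volume_sum_smul_convexHull U.1 (fun i => (U.2 i).1) ε hε
  simp only [h1, ← iSup_bodyMixedVolume_hull hA hne, ENNReal.mul_iSup]
  symm
  refine ENNReal.finsetSum_iSup_of_monotone fun I U W h => ?_
  refine mul_le_mul_right (ENNReal.ofReal_le_ofReal ?_) _
  exact bodyMixedVolume_hullBody_mono _ _ fun k => h (I k)

end Approximation

/-! ### Level sets of sums and the layer-cake formula -/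

section LevelSets

variable {n : ℕ}

/-- With strict inequalities a supremum exceeds `s` exactly when some term does, so no attainment is
needed. -/
theorem setOf_lt_oplus (f g : EuclideanSpace ℝ (Fin n) → ℝ≥0∞) (s : ℝ≥0∞) :
    {x | s < oplus f g x} = {x | s < f x} + {x | s < g x} := by
  ext x
  simp only [oplus, Set.mem_ofPred_eq, lt_iSup_iff, lt_min_iff, Set.mem_add]
  constructor
  · rintro ⟨y, h1, h2⟩
    exact ⟨y, h1, x - y, h2, by abel⟩
  · rintro ⟨y, h1, z, h2, rfl⟩
    exact ⟨y, h1, by simpa using h2⟩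

theorem setOf_lt_oplusSum : ∀ (m : ℕ) (g : Fin (m + 1) → EuclideanSpace ℝ (Fin n) → ℝ≥0∞)
    (s : ℝ≥0∞), {x | s < oplusSum m g x} = ∑ i, {x | s < g i x}
  | 0, g, s => by simp [oplusSum]
  | m + 1, g, s => by
    rw [Fin.sum_univ_castSucc, ← setOf_lt_oplusSum m (fun i => g i.castSucc) s, ← setOf_lt_oplus]
    rfl

theorem setOf_lt_odot {a : ℝ} (ha : 0 < a) (f : EuclideanSpace ℝ (Fin n) → ℝ≥0∞) (s : ℝ≥0∞) :
    {x | s < odot a f x} = a • {x | s < f x} := by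
  ext x
  rw [Set.mem_smul_set_iff_inv_smul_mem₀ ha.ne']
  rfl

theorem setOf_lt_toENN (f : EuclideanSpace ℝ (Fin n) → ℝ) {t : ℝ} (ht : 0 ≤ t) :
    {x | ENNReal.ofReal t < toENN f x} = {x | t < f x} := by
  ext x
  exact ENNReal.ofReal_lt_ofReal_iff_of_nonneg ht

theorem IsQC.convex_setOf_lt {f : EuclideanSpace ℝ (Fin n) → ℝ} (hf : IsQC f) (t : ℝ) :
    Convex ℝ {x | t < f x} := by
  simpa using hf.quasiconcave.convex_gt t

theorem IsQC.convex_setOf_lt_toENN {f : EuclideanSpace ℝ (Fin n) → ℝ} (hf : IsQC f) (s : ℝ≥0∞) :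
    Convex ℝ {x | s < toENN f x} := by
  by_cases hs : s = ⊤
  · simpa [hs] using convex_empty
  · rw [← ENNReal.ofReal_toReal hs, setOf_lt_toENN f ENNReal.toReal_nonneg]
    exact hf.convex_setOf_lt _

theorem nonempty_setOf_lt (f : EuclideanSpace ℝ (Fin n) → ℝ) {t : ℝ} (ht : 0 ≤ t) :
    {x | t < f x}.Nonempty ↔ ENNReal.ofReal t < height f := by
  rw [← setOf_lt_toENN f ht, height, lt_iSup_iff]
  rfl

/-- Convex sets are null-measurable, so `h` is measurable for the completed σ-algebra. -/
theorem aemeasurable_of_convex_setOf_lt {h : EuclideanSpace ℝ (Fin n) → ℝ≥0∞}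
    (hh : ∀ s, Convex ℝ {x | s < h x}) : AEMeasurable h := by
  refine NullMeasurable.aemeasurable ?_
  have : Measurable[NullMeasurableSpace.instMeasurableSpace (μ := volume)] h :=
    measurable_of_Ioi fun s => (hh s).nullMeasurableSet volume
  exact this

/-- The layer-cake formula for functions with values in `[0, ∞]`. -/
theorem lintegral_eq_lintegral_measure_ofReal_lt {α : Type*} [MeasurableSpace α] (μ : Measure α)
    {h : α → ℝ≥0∞} (hh : AEMeasurable h μ) :
    ∫⁻ x, h x ∂μ = ∫⁻ t in Set.Ioi (0 : ℝ), μ {x | ENNReal.ofReal t < h x} := by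
  by_cases htop : μ {x | h x = ⊤} = 0
  · have hae : ∀ᵐ x ∂μ, h x ≠ ⊤ := by simpa [ae_iff] using htop
    calc ∫⁻ x, h x ∂μ = ∫⁻ x, ENNReal.ofReal (h x).toReal ∂μ :=
          lintegral_congr_ae (hae.mono fun x hx => (ENNReal.ofReal_toReal hx).symm)
      _ = ∫⁻ t in Set.Ioi (0 : ℝ), μ {x | t < (h x).toReal} :=
          lintegral_eq_lintegral_meas_lt μ (Filter.Eventually.of_forall fun x =>
            ENNReal.toReal_nonneg) hh.ennreal_toReal
      _ = _ := by
          refine setLIntegral_congr_fun measurableSet_Ioi fun t ht => ?_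
          refine measure_congr (hae.mono fun x hx => ?_)
          exact propext (ENNReal.ofReal_lt_iff_lt_toReal (le_of_lt ht) hx).symm
  · rw [lintegral_eq_top_of_measure_eq_top_ne_zero hh htop, eq_comm, eq_top_iff]
    calc ⊤ = ∫⁻ _ in Set.Ioi (0 : ℝ), μ {x | h x = ⊤} := by
          rw [setLIntegral_const, Real.volume_Ioi, ENNReal.mul_top htop]
      _ ≤ _ := by
          refine lintegral_mono fun t => measure_mono fun x (hx : h x = ⊤) => ?_
          simp [hx]

end LevelSets

/-! ### Integration over the levels -/

section MixedIntegral

variable {n m : ℕ}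

theorem mixedVolume_mono {K K' : Fin n → Set (EuclideanSpace ℝ (Fin n))} (h : ∀ k, K k ⊆ K' k) :
    mixedVolume K ≤ mixedVolume K' :=
  iSup₂_le fun L hL => le_iSup₂_of_le L (fun k => (hL k).trans (h k)) le_rfl

theorem mixedVolume_eq_zero {K : Fin n → Set (EuclideanSpace ℝ (Fin n))} {k : Fin n}
    (h : K k = ∅) : mixedVolume K = 0 := by
  refine le_antisymm (iSup₂_le fun L hL => ?_) bot_le
  obtain ⟨x, hx⟩ := (L k).nonempty
  exact absurd (hL k hx) (by simp [h])

theorem bodyMixedVolume_comp_perm (L : Fin n → ConvexBody (EuclideanSpace ℝ (Fin n)))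
    (σ : Equiv.Perm (Fin n)) : bodyMixedVolume (fun k => L (σ k)) = bodyMixedVolume L := by
  unfold bodyMixedVolume
  congr 1
  refine Fintype.sum_equiv σ.finsetCongr _ _ fun S => ?_
  simp [Equiv.finsetCongr_apply]

theorem mixedVolume_comp_perm (K : Fin n → Set (EuclideanSpace ℝ (Fin n)))
    (σ : Equiv.Perm (Fin n)) : mixedVolume (fun k => K (σ k)) = mixedVolume K := by
  have h : ∀ (K : Fin n → Set (EuclideanSpace ℝ (Fin n))) (σ : Equiv.Perm (Fin n)),
      mixedVolume K ≤ mixedVolume (fun k => K (σ k)) := fun K σ =>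
    iSup₂_le fun L hL => le_iSup₂_of_le (fun k => L (σ k)) (fun k => hL (σ k))
      (by rw [bodyMixedVolume_comp_perm])
  refine le_antisymm ?_ (h K σ)
  simpa using h (fun k => K (σ k)) σ⁻¹

theorem antitone_mixedVolume_levelSet (g : Fin n → EuclideanSpace ℝ (Fin n) → ℝ) :
    Antitone fun t => mixedVolume fun k => levelSet (g k) t :=
  fun _ _ h => mixedVolume_mono fun _ _ hx => h.trans hx

theorem antitone_mixedVolume_setOf_lt (g : Fin n → EuclideanSpace ℝ (Fin n) → ℝ) :
    Antitone fun t => mixedVolume fun k => {x | t < g k x} :=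
  fun _ _ h => mixedVolume_mono fun _ _ hx => h.trans_lt hx

/-- The mixed volumes of the open and of the closed level sets agree at almost every level. -/
theorem mixedVolume_setOf_lt_ae_eq (g : Fin n → EuclideanSpace ℝ (Fin n) → ℝ) :
    (fun t => mixedVolume fun k => {x | t < g k x}) =ᵐ[volume]
      fun t => mixedVolume fun k => levelSet (g k) t := by
  -- A monotone function has countably many discontinuities. At a continuity point `t`, the open
  -- level set contains the closed ones at all `s > t`, and `s → t` gives the missing inequality.
  filter_upwards [(antitone_mixedVolume_levelSet g).countable_not_continuousAt.ae_notMem volume]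
    with t ht
  have hc : ContinuousAt (fun t => mixedVolume fun k => levelSet (g k) t) t := by
    simpa using ht
  refine le_antisymm (mixedVolume_mono fun k x (hx : t < g k x) => hx.le) ?_
  refine le_of_tendsto (hc.tendsto.mono_left nhdsWithin_le_nhds :
    Filter.Tendsto _ (nhdsWithin t (Set.Ioi t)) _) ?_
  filter_upwards [eventually_mem_nhdsWithin] with s hs
  exact mixedVolume_mono fun k x (hx : s ≤ g k x) => (Set.mem_Ioi.1 hs).trans_le hx

theorem measurableSet_levels (T : ℝ≥0∞) : MeasurableSet {t : ℝ | 0 < t ∧ ENNReal.ofReal t < T} :=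
  measurableSet_Ioi.inter (measurableSet_lt ENNReal.measurable_ofReal measurable_const)

/-- The volume of a level set of the sum is Minkowski's polynomial while all `{f i > t}` are
non-empty, that is for `t < T`, and zero afterwards. The cut-off is needed because a mixed volume in
the expansion may omit the function whose level set is empty. -/
theorem sumIntegral_eq {f : Fin (m + 1) → EuclideanSpace ℝ (Fin n) → ℝ} (hf : ∀ i, IsQC (f i))
    {ε : Fin (m + 1) → ℝ} (hε : ∀ i, 0 < ε i) :
    sumIntegral f ε = ∑ I : Fin n → Fin (m + 1), ENNReal.ofReal (∏ k, ε (I k)) *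
      mixedIntegralUpTo (⨅ j, height (f j)) fun k => f (I k) := by
  have hset : ∀ s : ℝ≥0∞, {x | s < oplusSum m (fun i => odot (ε i) (toENN (f i))) x} =
      ∑ i, ε i • {x | s < toENN (f i) x} := fun s => by
    rw [setOf_lt_oplusSum]
    exact Finset.sum_congr rfl fun i _ => setOf_lt_odot (hε i) _ s
  have hmeas : AEMeasurable (oplusSum m (fun i => odot (ε i) (toENN (f i)))) :=
    aemeasurable_of_convex_setOf_lt fun s => by
      rw [hset]
      exact convex_sum_smul (fun i => (hf i).convex_setOf_lt_toENN s) ε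
  set T := ⨅ j, height (f j) with hT
  set D := {t : ℝ | 0 < t ∧ ENNReal.ofReal t < T} with hD
  rw [sumIntegral, lintegral_eq_lintegral_measure_ofReal_lt volume hmeas,
    ← lintegral_indicator measurableSet_Ioi]
  have hind : ∀ t : ℝ, (Set.Ioi (0 : ℝ)).indicator (fun t => volume {x | ENNReal.ofReal t <
      oplusSum m (fun i => odot (ε i) (toENN (f i))) x}) t =
      D.indicator (fun t => ∑ I : Fin n → Fin (m + 1), ENNReal.ofReal (∏ k, ε (I k)) *
        mixedVolume fun k => {x | t < f (I k) x}) t := by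
    intro t
    by_cases ht : 0 < t
    swap
    · rw [Set.indicator_of_notMem (by simpa using ht), Set.indicator_of_notMem fun h => ht h.1]
    rw [Set.indicator_of_mem (by simpa using ht), hset]
    simp only [setOf_lt_toENN _ ht.le]
    by_cases hne : ∀ i, {x | t < f i x}.Nonempty
    · have htD : t ∈ D := by
        refine ⟨ht, ?_⟩
        obtain ⟨j, hj⟩ := exists_eq_ciInf_of_finite (f := fun j => height (f j))
        rw [hT, ← hj]
        exact (nonempty_setOf_lt _ ht.le).1 (hne j)
      rw [Set.indicator_of_mem htD]
      exact volume_sum_smul_eq_mixedVolume (fun i => (hf i).convex_setOf_lt t) hne hε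
    · push Not at hne
      obtain ⟨j, hj⟩ := hne
      have htD : t ∉ D := fun h => by
        have := (nonempty_setOf_lt (f j) ht.le).2 (h.2.trans_le (iInf_le _ j))
        simp [hj] at this
      rw [Set.indicator_of_notMem htD]
      refine measure_mono_null (fun x hx => ?_) measure_empty
      obtain ⟨g, hg, -⟩ := (Set.mem_fintype_sum _ _).1 hx
      simpa [hj] using hg j
  simp only [hind]
  rw [lintegral_indicator (measurableSet_levels T), lintegral_finsetSum]
  · refine Finset.sum_congr rfl fun I _ => ?_
    rw [lintegral_const_mul _ (antitone_mixedVolume_setOf_lt fun k => f (I k)).measurable]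
    congr 1
    exact lintegral_congr_ae (ae_restrict_of_ae (mixedVolume_setOf_lt_ae_eq fun k => f (I k)))
  · exact fun I _ => (antitone_mixedVolume_setOf_lt fun k => f (I k)).measurable.const_mul _

theorem mixedIntegralUpTo_eq_mixedIntegral (g : Fin n → EuclideanSpace ℝ (Fin n) → ℝ) {T : ℝ≥0∞}
    {k : Fin n} (hk : height (g k) ≤ T) : mixedIntegralUpTo T g = mixedIntegral g := by
  rw [mixedIntegralUpTo, mixedIntegral, ← lintegral_indicator (measurableSet_levels T),
    ← lintegral_indicator measurableSet_Ioi]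
  refine lintegral_congr_ae ?_
  -- At the level `T` itself the closed level set of `g k` may be non-empty, if the supremum is
  -- attained. For `T = ⊤` the excluded level is the default value `0`, which is harmless.
  filter_upwards [Measure.ae_ne volume T.toReal] with t hne
  by_cases ht : 0 < t
  swap
  · rw [Set.indicator_of_notMem fun h => ht h.1, Set.indicator_of_notMem (by simpa using ht)]
  rw [Set.indicator_of_mem (s := Set.Ioi 0) ht]
  by_cases htT : ENNReal.ofReal t < T
  · rw [Set.indicator_of_mem (show t ∈ {t : ℝ | 0 < t ∧ ENNReal.ofReal t < T} from ⟨ht, htT⟩)]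
  · rw [Set.indicator_of_notMem fun h => htT h.2, mixedVolume_eq_zero (k := k)]
    by_contra h
    obtain ⟨x, hx⟩ := Set.nonempty_iff_ne_empty.2 h
    have h1 : ENNReal.ofReal t ≤ T := (ENNReal.ofReal_le_ofReal hx).trans
      ((le_iSup (toENN (g k)) x).trans hk)
    have h2 := le_antisymm h1 (not_lt.1 htT)
    exact hne (by rw [← h2, ENNReal.toReal_ofReal ht.le])

end MixedIntegral

/-! ### Uniqueness of symmetric coefficients -/

section Uniqueness

variable {n m : ℕ}

/-- Equal exponent vectors mean fibres of equal size; bijections between the fibres glue to a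
permutation. -/
theorem exists_perm_of_sum_single_eq {I J : Fin n → Fin m}
    (h : ∑ k, Finsupp.single (I k) (1 : ℕ) = ∑ k, Finsupp.single (J k) 1) :
    ∃ σ : Equiv.Perm (Fin n), I = J ∘ σ := by
  have hcard : ∀ i, Nonempty ({k // I k = i} ≃ {k // J k = i}) := by
    intro i
    have h1 := DFunLike.congr_fun h i
    simp only [Finsupp.coe_finsetSum, Finset.sum_apply, Finsupp.single_apply,
      Finset.sum_boole, Nat.cast_id] at h1
    exact ⟨Fintype.equivOfCardEq (by rw [Fintype.card_subtype, Fintype.card_subtype, h1])⟩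
  let e := fun i => (hcard i).some
  exact ⟨Equiv.ofFiberEquiv e, funext fun k => (Equiv.ofFiberEquiv_map e k).symm⟩

/-- Polynomials agreeing on the positive orthant coincide. By symmetry the coefficient of a monomial
is `c J` times the positive number of index tuples giving that monomial. -/
theorem symm_coeff_unique {c d : (Fin n → Fin m) → ℝ}
    (hc : ∀ (σ : Equiv.Perm (Fin n)) (I : Fin n → Fin m), c (I ∘ σ) = c I)
    (hd : ∀ (σ : Equiv.Perm (Fin n)) (I : Fin n → Fin m), d (I ∘ σ) = d I)
    (h : ∀ ε : Fin m → ℝ, (∀ i, 0 < ε i) →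
      ∑ I : Fin n → Fin m, (∏ k, ε (I k)) * c I = ∑ I : Fin n → Fin m, (∏ k, ε (I k)) * d I) :
    c = d := by
  classical
  let P : ((Fin n → Fin m) → ℝ) → MvPolynomial (Fin m) ℝ := fun c =>
    ∑ I : Fin n → Fin m, MvPolynomial.C (c I) * ∏ k, MvPolynomial.X (I k)
  have heval : ∀ (c : (Fin n → Fin m) → ℝ) (ε : Fin m → ℝ),
      MvPolynomial.eval ε (P c) = ∑ I : Fin n → Fin m, (∏ k, ε (I k)) * c I := by
    intro c ε
    simp only [P, map_sum, map_mul, map_prod, MvPolynomial.eval_C, MvPolynomial.eval_X]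
    exact Finset.sum_congr rfl fun I _ => mul_comm _ _
  have hP : P c = P d := by
    refine MvPolynomial.funext_set (fun _ => Set.Ioi (0 : ℝ)) (fun _ => Set.Ioi_infinite 0)
      fun ε hε => ?_
    rw [heval, heval]
    exact h ε fun i => by simpa using hε i (Set.mem_univ i)
  have hcoeff : ∀ c : (Fin n → Fin m) → ℝ,
      (∀ (σ : Equiv.Perm (Fin n)) (I : Fin n → Fin m), c (I ∘ σ) = c I) → ∀ J : Fin n → Fin m,
      MvPolynomial.coeff (∑ k, Finsupp.single (J k) 1) (P c) =
        (Finset.univ.filter fun I : Fin n → Fin m => ∑ k, Finsupp.single (I k) (1 : ℕ) =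
          ∑ k, Finsupp.single (J k) 1).card * c J := by
    intro c hc J
    have hX : ∀ I : Fin n → Fin m, ∏ k, (MvPolynomial.X (I k) : MvPolynomial (Fin m) ℝ) =
        MvPolynomial.monomial (∑ k, Finsupp.single (I k) 1) 1 := fun I => by
      rw [MvPolynomial.monomial_sum_one]; rfl
    simp only [P, hX, MvPolynomial.coeff_sum, MvPolynomial.coeff_C_mul,
      MvPolynomial.coeff_monomial, mul_ite, mul_one, mul_zero]
    rw [← Finset.sum_filter, Finset.sum_congr rfl fun I hI => ?_, Finset.sum_const, nsmul_eq_mul]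
    obtain ⟨σ, rfl⟩ := exists_perm_of_sum_single_eq (Finset.mem_filter.1 hI).2
    exact hc σ J
  funext J
  have h1 := hcoeff c hc J
  rw [hP, hcoeff d hd J] at h1
  refine (mul_left_cancel₀ ?_ h1).symm
  rw [Nat.cast_ne_zero, Finset.card_ne_zero]
  exact ⟨J, by simp⟩

/-- All monomials are positive at `ε₀`, so one finite value of `F` makes every coefficient of either
expansion finite, and the real case applies. -/
theorem IsSymmExpansion.unique {F : (Fin m → ℝ) → ℝ≥0∞} {c d : (Fin n → Fin m) → ℝ≥0∞}
    (hc : IsSymmExpansion F c) (hd : IsSymmExpansion F d)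
    (hF : ∃ ε : Fin m → ℝ, (∀ i, 0 < ε i) ∧ F ε ≠ ⊤) : c = d := by
  obtain ⟨ε₀, hε₀, hfin⟩ := hF
  have hpos : ∀ (ε : Fin m → ℝ), (∀ i, 0 < ε i) → ∀ I : Fin n → Fin m, 0 < ∏ k, ε (I k) :=
    fun ε hε I => Finset.prod_pos fun k _ => hε _
  have hne : ∀ c : (Fin n → Fin m) → ℝ≥0∞, IsSymmExpansion F c → ∀ I, c I ≠ ⊤ := by
    intro c hc I hI
    apply hfin
    rw [hc.2 ε₀ hε₀, ENNReal.sum_eq_top]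
    refine ⟨I, Finset.mem_univ I, ?_⟩
    rw [hI, ENNReal.mul_top]
    simpa using hpos ε₀ hε₀ I
  have hreal : ∀ c : (Fin n → Fin m) → ℝ≥0∞, IsSymmExpansion F c → ∀ ε : Fin m → ℝ,
      (∀ i, 0 < ε i) → (F ε).toReal = ∑ I : Fin n → Fin m, (∏ k, ε (I k)) * (c I).toReal := by
    intro c hc ε hε
    rw [hc.2 ε hε, ENNReal.toReal_sum fun I _ =>
      ENNReal.mul_ne_top ENNReal.ofReal_ne_top (hne c hc I)]
    exact Finset.sum_congr rfl fun I _ => by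
      rw [ENNReal.toReal_mul, ENNReal.toReal_ofReal (hpos ε hε I).le]
  have h := symm_coeff_unique (c := fun I => (c I).toReal) (d := fun I => (d I).toReal)
    (fun σ I => by rw [hc.1]) (fun σ I => by rw [hd.1])
    fun ε hε => by rw [← hreal c hc ε hε, hreal d hd ε hε]
  funext I
  exact (ENNReal.toReal_eq_toReal_iff' (hne c hc I) (hne d hd I)).1 (congrFun h I)

theorem isSymmExpansion_sumIntegral {f : Fin (m + 1) → EuclideanSpace ℝ (Fin n) → ℝ}
    (hf : ∀ i, IsQC (f i)) :
    IsSymmExpansion (sumIntegral f) fun I : Fin n → Fin (m + 1) =>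
      mixedIntegralUpTo (⨅ j, height (f j)) fun k => f (I k) := by
  refine ⟨fun σ I => ?_, fun ε hε => sumIntegral_eq hf hε⟩
  refine lintegral_congr fun t => ?_
  exact mixedVolume_comp_perm (fun k => levelSet (f (I k)) t) σ

end Uniqueness

end QuasiConcave

end

theorem mainTheorem1 {n m : ℕ} (f : Fin (m + 1) → EuclideanSpace ℝ (Fin n) → ℝ)
    (hf : ∀ i, QuasiConcave.IsQC (f i)) :
    -- `F` is a homogeneous polynomial of degree `n` with symmetric coefficients in `[0, ∞]`,
    -- given by integrals of mixed volumes up to the smallest of the suprema of the functions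
    QuasiConcave.IsSymmExpansion (QuasiConcave.sumIntegral f)
      (fun I : Fin n → Fin (m + 1) =>
        QuasiConcave.mixedIntegralUpTo (⨅ j, QuasiConcave.height (f j)) fun k => f (I k)) ∧
    -- if `F` is finite somewhere, these are the only symmetric coefficients
    (∀ c : (Fin n → Fin (m + 1)) → ENNReal,
      QuasiConcave.IsSymmExpansion (QuasiConcave.sumIntegral f) c →
      (∃ ε : Fin (m + 1) → ℝ, (∀ i, 0 < ε i) ∧ QuasiConcave.sumIntegral f ε ≠ ⊤) →
      ∀ I : Fin n → Fin (m + 1), c I =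
        QuasiConcave.mixedIntegralUpTo (⨅ j, QuasiConcave.height (f j)) fun k => f (I k)) ∧
    -- a coefficient that involves all the functions is the full mixed integral
    (∀ I : Fin n → Fin (m + 1), Function.Surjective I →
      QuasiConcave.mixedIntegralUpTo (⨅ j, QuasiConcave.height (f j)) (fun k => f (I k)) =
        QuasiConcave.mixedIntegral fun k => f (I k)) ∧
    -- and so is every coefficient that involves a function of smallest supremum; in particular
    -- every coefficient, if `n ≥ 1` and all the functions have the same supremum
    (∀ I : Fin n → Fin (m + 1),
      (∃ k, ∀ j, QuasiConcave.height (f (I k)) ≤ QuasiConcave.height (f j)) →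
      QuasiConcave.mixedIntegralUpTo (⨅ j, QuasiConcave.height (f j)) (fun k => f (I k)) =
        QuasiConcave.mixedIntegral fun k => f (I k)) := by
  have hexp := QuasiConcave.isSymmExpansion_sumIntegral hf
  refine ⟨hexp, fun c hc hfin I => congrFun (hc.unique hexp hfin) I, fun I hI => ?_,
    fun I ⟨k, hk⟩ => ?_⟩
  · obtain ⟨j, hj⟩ := exists_eq_ciInf_of_finite (f := fun j => QuasiConcave.height (f j))
    obtain ⟨k, rfl⟩ := hI j
    exact QuasiConcave.mixedIntegralUpTo_eq_mixedIntegral (fun k => f (I k)) (k := k) hj.le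
  · exact QuasiConcave.mixedIntegralUpTo_eq_mixedIntegral (fun k => f (I k)) (k := k)
      (le_iInf hk)
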